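/- Let $A$ be a unital AF-algebra, $A=\overline{\bigcup_{n\in\mathbb N}A_n}^{\|\cdot\|}$, where $\mathbb{C}1_A=A_0\subseteq A_1\subseteq A_2\subseteq\cdots$ are finite-dimensional C*-subalgebras of $A$, and let $\tau$ be a faithful tracial state on $A$. Let $E_n:A\to A_n$ be the unique $\tau$-preserving conditional expectation onto $A_n$. Let $(\beta(n))_{n\in\mathbb N}$ be a sequence in $(0,\infty)$ such that $\beta(n)\to0$ and $\beta(n)/\beta(n-1)\to0$ as $n\to\infty$. For $a\in A$ put $$L_\beta(a)=\sup_{n\in\mathbb N}\frac{\|a-E_n(a)\|_A}{\beta(n)}\in[0,\infty].$$ Let $\mathrm{Ideals}(A)$ be the set of norm-closed two-sided ideals of $A$. For $I\in \mathrm{Ideals}(A)$ and $n\in\mathbb N$ let $1_n$ be the unit of the finite-dimensional C*-algebra $I\cap A_n$ (so $1_n$ depends on $I$), and for $\omega,\nu\in I$ put $\langle\omega,\nu\rangle_I=\omega\nu^*$ and $$D_I(\omega)=\max\Big\{L_\beta(\omega),\ \|\omega\|_A,\ \sup_{n\in\mathbb N}\frac{\|\omega-\omega1_n\|_A}{\beta(n)}\Big\}\in[0,\infty].$$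 Let $F(x_1,x_2,x_3,x_4)=2(x_1x_4+x_2x_3)$, $G(x,y,z)=F(x,y,z,z)$ and $H(x,y)=F(x,x,y,y)$ on $[0,\infty)^4$, $[0,\infty)^3$ and $[0,\infty)^2$. Then for every $I\in\mathrm{Ideals}(A)$ $$\Omega^\beta_I=(I,\langle\cdot,\cdot\rangle_I,D_I,A,L_\beta)$$ is an $(F,G,H)$-metrized quantum vector bundle in the sense of Latrémolière ($L_\beta$ being restricted to the self-adjoint elements, and the domains of $L_\beta$ and $D_I$ being the sets where they are finite), and the map $$I\in \mathrm{Ideals}(A)\longmapsto\Omega^\beta_I$$ is continuous from the Fell topology to the topology induced by Latrémolière's modular Gromov–Hausdorff propinquity $\Lambda^{\mathrm{mod}}$ on the class of $(F,G,H)$-metrized quantum vector bundles. Here the Fell topology on $\mathrm{Ideals}(A)$ is transported, along $I\mapsto\{P\in\mathrm{Prim}(A):I\subseteq P\}$, from the Fell topology on the closed subsets $Y$ of the primitive ideal space $\mathrm{Prim}(A)$ with its Jacobson topology, which is generated by the sets $\{Y: Y\cap C=\emptyset\}$ ($C$ compact) and $\{Y: Y\cap U\ne\emptyset\}$ ($U$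 open). The distance $\Lambda^{\mathrm{mod}}(\Omega,\Omega')$ is the infimum of the total lengths of finite chains of modular bridges from $\Omega$ to $\Omega'$ through $(F,G,H)$-metrized quantum vector bundles, the length of a modular bridge being the maximum of its height and its reach. -/

import Mathlib

open Topology
open scoped ENNReal NNReal ComplexOrder ComplexStarModule

universe u

namespace ModularPropinquity

/-! ### States, Monge–Kantorovich metrics, quantum compact metric spaces -/

section States

/-- The state space `S(A)` of a unital C⋆-algebra: positive linear functionals with value `1`
at `1`. -/
noncomputable def State (A : Type u) [CStarAlgebra A] : Type u :=
  {φ : A →ₗ[ℂ] ℂ // (∀ a : A, 0 ≤ φ (star a * a)) ∧ φ 1 = 1}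

/-- The weak-⋆ topology on the state space (pointwise convergence on `A`). -/
noncomputable instance (A : Type u) [CStarAlgebra A] : TopologicalSpace (State A) :=
  TopologicalSpace.induced (fun φ (a : A) => φ.1 a) inferInstance

/-- The state `φ ∘ π` for a unital ⋆-morphism `π`. -/
noncomputable def State.pullback {A D : Type u} [CStarAlgebra A] [CStarAlgebra D] (π : A →⋆ₐ[ℂ] D)
    (φ : State D) : State A :=
  ⟨φ.1 ∘ₗ (π : A →⋆ₐ[ℂ] D).toAlgHom.toLinearMap,
    fun a => by simpa [map_star] using φ.2.1 (π a), by simpa using φ.2.2⟩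

/-- The Monge–Kantorovich metric `mk_L` on `S(A)`, as an extended distance.  A seminorm `L` defined
on a subspace of `sa(A)` is encoded by the value `∞` off its domain. -/
noncomputable def mkDist {A : Type u} [CStarAlgebra A] (L : selfAdjoint A → ℝ≥0∞)
    (φ ψ : State A) : ℝ≥0∞ :=
  ⨆ (a : selfAdjoint A) (_ : L a ≤ 1), ‖φ.1 (a : A) - ψ.1 (a : A)‖ₑ

end States

/-- Admissible functions `F : [0,∞)⁴ → [0,∞)`. -/
def AdmissibleF (F : ℝ≥0 → ℝ≥0 → ℝ≥0 → ℝ≥0 → ℝ≥0) : Prop :=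
  (∀ x₁ x₂ x₃ x₄ y₁ y₂ y₃ y₄, x₁ ≤ y₁ → x₂ ≤ y₂ → x₃ ≤ y₃ → x₄ ≤ y₄ →
    F x₁ x₂ x₃ x₄ ≤ F y₁ y₂ y₃ y₄) ∧
  ∀ x₁ x₂ x₃ x₄, x₁ * x₄ + x₂ * x₃ ≤ F x₁ x₂ x₃ x₄

/-- Admissible triples `(F, G, H)`. -/
def AdmissibleTriple (F : ℝ≥0 → ℝ≥0 → ℝ≥0 → ℝ≥0 → ℝ≥0) (G : ℝ≥0 → ℝ≥0 → ℝ≥0 → ℝ≥0)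
    (H : ℝ≥0 → ℝ≥0 → ℝ≥0) : Prop :=
  AdmissibleF F ∧
  ((∀ x y z x' y' z', x ≤ x' → y ≤ y' → z ≤ z' → G x y z ≤ G x' y' z') ∧
    ∀ x y z, (x + y) * z ≤ G x y z) ∧
  ((∀ x y x' y', x ≤ x' → y ≤ y' → H x y ≤ H x' y') ∧ ∀ x y, 2 * x * y ≤ H x y)

/-- `(A, L)` is an `F`-Leibniz quantum compact metric space.  The domain of `L` is `{L < ∞}`, which
is a subspace by `add_le` and `smul`, and a Jordan–Lie subalgebra by `leibniz`.  For `a, b ∈ sa(A)`,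
the real part `ℜ (ab)` is the Jordan product `(ab + ba)/2` and the imaginary part `ℑ (ab)` is the
Lie product `(ab - ba)/(2i)`. -/
structure IsQuantumCompactMetricSpace (F : ℝ≥0 → ℝ≥0 → ℝ≥0 → ℝ≥0 → ℝ≥0) (A : Type u)
    [CStarAlgebra A] (L : selfAdjoint A → ℝ≥0∞) : Prop where
  nontrivial : Nontrivial A
  add_le : ∀ a b, L (a + b) ≤ L a + L b
  smul : ∀ (t : ℝ) a, L (t • a) = ‖t‖ₑ * L a
  dense_dom : Dense {a : selfAdjoint A | L a ≠ ∞}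
  eq_zero_iff : ∀ a, L a = 0 ↔ ∃ t : ℝ, a = t • (1 : selfAdjoint A)
  /-- `mk_L` takes finite values, and its open balls are a basis of weak-⋆ neighbourhoods. -/
  mk_ne_top : ∀ φ ψ : State A, mkDist L φ ψ ≠ ∞
  mk_metrizes : ∀ φ : State A,
    (𝓝 φ).HasBasis (fun ε : ℝ≥0∞ => 0 < ε) (fun ε => {ψ | mkDist L ψ φ < ε})
  lowerSemicontinuous : IsClosed {a : selfAdjoint A | L a ≤ 1}
  leibniz : ∀ a b : selfAdjoint A, L a ≠ ∞ → L b ≠ ∞ →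
    max (L (ℜ ((a : A) * (b : A)))) (L (ℑ ((a : A) * (b : A)))) ≤
      F ‖(a : A)‖₊ ‖(b : A)‖₊ (L a).toNNReal (L b).toNNReal

/-! ### Metrized quantum vector bundles -/

/-- The data `(M, ⟨·,·⟩, D, A, L)` underlying a metrized quantum vector bundle: a unital C⋆-algebra
`A`, a left Hilbert `A`-module `M`, a `[0,∞]`-valued function `L` on `sa(A)` and a `[0,∞]`-valued
function `D` on `M` (with value `∞` off the domains).  Mathlib's `CStarModule` has an inner product
that is `A`-linear for the left action in its *second* variable, so that `⟨ω, η⟩` is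
`inner A η ω`. -/
structure BundleData : Type (u + 1) where
  Alg : Type u
  Mod : Type u
  [cstar : CStarAlgebra Alg]
  [order : PartialOrder Alg]
  [starOrdered : StarOrderedRing Alg]
  [normedGroup : NormedAddCommGroup Mod]
  [normedSpace : NormedSpace ℂ Mod]
  [complete : CompleteSpace Mod]
  [module : Module Alg Mod]
  [hilbert : CStarModule Alg Mod]
  L : selfAdjoint Alg → ℝ≥0∞
  D : Mod → ℝ≥0∞

attribute [instance] BundleData.cstar BundleData.order BundleData.starOrdered
  BundleData.normedGroup BundleData.normedSpace BundleData.complete BundleData.module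
  BundleData.hilbert

/-- The `A`-valued inner product `⟨ω, η⟩`, linear in `ω`. -/
noncomputable def BundleData.ip (Ω : BundleData.{u}) (ω η : Ω.Mod) : Ω.Alg := inner Ω.Alg η ω

/-- `Ω` is an `(F, G, H)`-metrized quantum vector bundle. -/
structure IsMetrizedBundle (F : ℝ≥0 → ℝ≥0 → ℝ≥0 → ℝ≥0 → ℝ≥0) (G : ℝ≥0 → ℝ≥0 → ℝ≥0 → ℝ≥0)
    (H : ℝ≥0 → ℝ≥0 → ℝ≥0) (Ω : BundleData.{u}) : Prop where
  admissible : AdmissibleTriple F G H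
  base : IsQuantumCompactMetricSpace F Ω.Alg Ω.L
  add_le : ∀ ω η, Ω.D (ω + η) ≤ Ω.D ω + Ω.D η
  smul : ∀ (c : ℂ) ω, Ω.D (c • ω) = ‖c‖ₑ * Ω.D ω
  dense_dom : Dense {ω | Ω.D ω ≠ ∞}
  norm_le : ∀ ω, ‖ω‖ₑ ≤ Ω.D ω
  compact : IsCompact {ω | Ω.D ω ≤ 1}
  module_leibniz : ∀ (a : selfAdjoint Ω.Alg) (ω : Ω.Mod), Ω.L a ≠ ∞ → Ω.D ω ≠ ∞ →
    Ω.D ((a : Ω.Alg) • ω) ≤ G ‖(a : Ω.Alg)‖₊ (Ω.L a).toNNReal (Ω.D ω).toNNReal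
  inner_leibniz : ∀ ω η : Ω.Mod, Ω.D ω ≠ ∞ → Ω.D η ≠ ∞ →
    max (Ω.L (ℜ (Ω.ip ω η))) (Ω.L (ℑ (Ω.ip ω η))) ≤ H (Ω.D ω).toNNReal (Ω.D η).toNNReal

/-- The class of `(F, G, H)`-metrized quantum vector bundles. -/
structure MetrizedBundle (F : ℝ≥0 → ℝ≥0 → ℝ≥0 → ℝ≥0 → ℝ≥0) (G : ℝ≥0 → ℝ≥0 → ℝ≥0 → ℝ≥0)
    (H : ℝ≥0 → ℝ≥0 → ℝ≥0) : Type (u + 1) where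
  data : BundleData.{u}
  isMetrized : IsMetrizedBundle F G H data

/-- The modular Monge–Kantorovich metric `k_Ω`. -/
noncomputable def BundleData.modularMK (Ω : BundleData.{u}) (ω η : Ω.Mod) : ℝ≥0∞ :=
  ⨆ (ξ : Ω.Mod) (_ : Ω.D ξ ≤ 1), ‖Ω.ip ω ξ - Ω.ip η ξ‖ₑ

/-! ### Modular bridges -/

/-- The `[0,∞]`-valued Hausdorff distance between `S` and `T` for a distance-like function `d`. -/
noncomputable def haus {X Y : Type*} (d : X → Y → ℝ≥0∞) (S : Set X) (T : Set Y) : ℝ≥0∞ :=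
  max (⨆ s ∈ S, ⨅ t ∈ T, d s t) (⨆ t ∈ T, ⨅ s ∈ S, d s t)

/-- The `1`-level set `S₁(D|x)` of `x`. -/
def levelSet {D : Type u} [CStarAlgebra D] (x : D) : Set (State D) :=
  {φ | φ.1 (star (1 - x) * (1 - x)) = 0 ∧ φ.1 ((1 - x) * star (1 - x)) = 0}

/-- Modular bridges from `Ω₁` to `Ω₂`. -/
structure ModularBridge (Ω₁ Ω₂ : BundleData.{u}) : Type (u + 1) where
  D : Type u
  [cstar : CStarAlgebra D]
  pivot : D
  norm_pivot_le : ‖pivot‖ ≤ 1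
  levelSet_nonempty : (levelSet pivot).Nonempty
  π₁ : Ω₁.Alg →⋆ₐ[ℂ] D
  π₂ : Ω₂.Alg →⋆ₐ[ℂ] D
  injective₁ : Function.Injective π₁
  injective₂ : Function.Injective π₂
  J : Type u
  nonempty : Nonempty J
  anchor : J → Ω₁.Mod
  coanchor : J → Ω₂.Mod
  anchor_le : ∀ j, Ω₁.D (anchor j) ≤ 1
  coanchor_le : ∀ j, Ω₂.D (coanchor j) ≤ 1

attribute [instance] ModularBridge.cstar

namespace ModularBridge

variable {Ω₁ Ω₂ : BundleData.{u}} (γ : ModularBridge Ω₁ Ω₂)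

/-- The bridge seminorm `bn(a, b) = ‖π₁(a) x - x π₂(b)‖`. -/
noncomputable def bn (a : Ω₁.Alg) (b : Ω₂.Alg) : ℝ≥0∞ :=
  ‖γ.π₁ a * γ.pivot - γ.pivot * γ.π₂ b‖ₑ

/-- The height: how far the states that the `1`-level set of the pivot induces are from all
states. -/
noncomputable def height : ℝ≥0∞ :=
  max (haus (mkDist Ω₁.L) Set.univ (State.pullback γ.π₁ '' levelSet γ.pivot))
    (haus (mkDist Ω₂.L) Set.univ (State.pullback γ.π₂ '' levelSet γ.pivot))

/-- The reach of the basic bridge: the Hausdorff distance between `{π₁(a) x : L₁(a) ≤ 1}` and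
`{x π₂(b) : L₂(b) ≤ 1}`, for self-adjoint `a`, `b`. -/
noncomputable def basicReach : ℝ≥0∞ :=
  haus (fun (a : selfAdjoint Ω₁.Alg) (b : selfAdjoint Ω₂.Alg) => γ.bn (a : Ω₁.Alg) (b : Ω₂.Alg))
    {a | Ω₁.L a ≤ 1} {b | Ω₂.L b ≤ 1}

/-- The deck seminorm. -/
noncomputable def dn (ω : Ω₁.Mod) (η : Ω₂.Mod) : ℝ≥0∞ :=
  ⨆ j, max (γ.bn (Ω₁.ip ω (γ.anchor j)) (Ω₂.ip η (γ.coanchor j)))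
    (γ.bn (Ω₁.ip (γ.anchor j) ω) (Ω₂.ip (γ.coanchor j) η))

/-- The modular reach. -/
noncomputable def modularReach : ℝ≥0∞ := ⨆ j, γ.dn (γ.anchor j) (γ.coanchor j)

/-- The imprint. -/
noncomputable def imprint : ℝ≥0∞ :=
  max (haus Ω₁.modularMK (Set.range γ.anchor) {ω | Ω₁.D ω ≤ 1})
    (haus Ω₂.modularMK (Set.range γ.coanchor) {ω | Ω₂.D ω ≤ 1})

/-- The reach. -/
noncomputable def reach : ℝ≥0∞ := max γ.basicReach (γ.modularReach + γ.imprint)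

/-- The length `λ(γ)`. -/
noncomputable def length : ℝ≥0∞ := max γ.height γ.reach

end ModularBridge

/-! ### Treks and the modular propinquity -/

section Treks

variable (F : ℝ≥0 → ℝ≥0 → ℝ≥0 → ℝ≥0 → ℝ≥0) (G : ℝ≥0 → ℝ≥0 → ℝ≥0 → ℝ≥0) (H : ℝ≥0 → ℝ≥0 → ℝ≥0)

/-- Modular treks: nonempty finite chains of modular bridges through `(F, G, H)`-metrized quantum
vector bundles. -/
inductive Trek : MetrizedBundle.{u} F G H → MetrizedBundle.{u} F G H → Type (u + 1)
  | single {Ω₁ Ω₂ : MetrizedBundle.{u} F G H} (γ : ModularBridge Ω₁.1 Ω₂.1) : Trek Ω₁ Ω₂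
  | cons {Ω₁ Ω₂ Ω₃ : MetrizedBundle.{u} F G H} (γ : ModularBridge Ω₁.1 Ω₂.1)
      (Γ : Trek Ω₂ Ω₃) : Trek Ω₁ Ω₃

variable {F G H}

/-- The length of a trek is the sum of the lengths of its bridges. -/
noncomputable def Trek.length : {Ω Ω' : MetrizedBundle.{u} F G H} → Trek F G H Ω Ω' → ℝ≥0∞
  | _, _, .single γ => γ.length
  | _, _, .cons γ Γ => γ.length + Γ.length

/-- The modular Gromov–Hausdorff propinquity `Λ^mod`, on `(F, G, H)`-metrized quantum vector
bundles: the infimum of the lengths of the modular treks. -/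
noncomputable def propinquity (Ω Ω' : MetrizedBundle.{u} F G H) : ℝ≥0∞ :=
  ⨅ Γ : Trek F G H Ω Ω', Γ.length

end Treks

/-! ### The propinquity is a pseudo-distance -/

lemma haus_self_le {X : Type*} (d : X → X → ℝ≥0∞) (hd : ∀ x, d x x = 0) (S : Set X) :
    haus d S S = 0 := by
  refine le_antisymm (max_le ?_ ?_) zero_le <;>
  · refine iSup₂_le fun s hs => ?_
    exact (iInf₂_le s hs).trans (hd s).le

lemma haus_swap {X Y : Type*} (d : X → Y → ℝ≥0∞) (S : Set X) (T : Set Y) :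
    haus (fun t s => d s t) T S = haus d S T := max_comm _ _

/-- A nontrivial unital C⋆-algebra has a state. -/
lemma exists_state (A : Type u) [CStarAlgebra A] [Nontrivial A] : Nonempty (State A) := by
  let _ := CStarAlgebra.spectralOrder A
  have := CStarAlgebra.spectralOrderedRing A
  obtain ⟨f, hf1, hf⟩ := exists_dual_vector ℂ (1 : A) (norm_ne_zero_iff.2 one_ne_zero)
  have hf' : f 1 = 1 := by simpa using hf
  have hre : ∀ a : A, IsSelfAdjoint a → (f a).im = 0 := by
    intro a ha
    by_contra h
    have key : ∀ t : ℝ, ((f a).im + t) ^ 2 ≤ ‖a‖ ^ 2 + t ^ 2 := by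
      intro t
      have h1 : ‖f (a + (Complex.I * t) • (1 : A))‖ ≤ ‖a + (Complex.I * t) • (1 : A)‖ := by
        simpa [hf1] using f.le_opNorm (a + (Complex.I * t) • (1 : A))
      have h2 : ‖a + (Complex.I * t) • (1 : A)‖ ^ 2 ≤ ‖a‖ ^ 2 + t ^ 2 := by
        have : star (a + (Complex.I * t) • (1 : A)) * (a + (Complex.I * t) • (1 : A))
            = a * a + ((t : ℂ) ^ 2) • (1 : A) := by
          rw [star_add, star_smul, ha.star_eq, star_one]
          simp only [add_mul, mul_add, smul_mul_assoc, mul_smul_comm, one_mul, mul_one, smul_add,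
            smul_smul]
          have e : star (Complex.I * (t : ℂ)) = -(Complex.I * t) := by simp
          have e3 : Complex.I * (t : ℂ) * -(Complex.I * t) = (t : ℂ) ^ 2 := by
            linear_combination (-(t : ℂ) ^ 2) * Complex.I_sq
          rw [e, e3, neg_smul]
          abel
        calc _ = ‖star (a + (Complex.I * t) • (1 : A)) * (a + (Complex.I * t) • (1 : A))‖ := by
              rw [CStarRing.norm_star_mul_self, sq]
          _ ≤ ‖a * a‖ + ‖((t : ℂ) ^ 2) • (1 : A)‖ := by rw [this]; exact norm_add_le _ _
          _ ≤ _ := by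
              rw [norm_smul]
              gcongr
              · rw [sq]; exact norm_mul_le _ _
              · simp
      have h3 : ((f a).im + t) ^ 2 ≤ ‖f (a + (Complex.I * t) • (1 : A))‖ ^ 2 := by
        rw [← sq_abs]
        gcongr
        have := Complex.abs_im_le_norm (f (a + (Complex.I * t) • (1 : A)))
        simpa [hf'] using this
      calc _ ≤ _ := h3
        _ ≤ ‖a + (Complex.I * t) • (1 : A)‖ ^ 2 := by gcongr
        _ ≤ _ := h2
    have := key ((‖a‖ ^ 2 + 1) / (f a).im)
    have e : (f a).im * ((‖a‖ ^ 2 + 1) / (f a).im) = ‖a‖ ^ 2 + 1 := by field_simp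
    nlinarith [sq_nonneg (f a).im, sq_nonneg ‖a‖]
  refine ⟨⟨f.toLinearMap, fun a => ?_, by simpa using hf'⟩⟩
  have hpos : 0 ≤ star a * a := star_mul_self_nonneg a
  set b := star a * a with hb
  have him := hre b (IsSelfAdjoint.star_mul_self a)
  have hb' : ‖(‖b‖ : ℂ) • (1 : A) - b‖ ≤ ‖b‖ := by
    have h0 : 0 ≤ algebraMap ℝ A ‖b‖ - b :=
      sub_nonneg.2 (IsSelfAdjoint.le_algebraMap_norm_self (IsSelfAdjoint.star_mul_self a))
    have := (CStarAlgebra.norm_le_iff_le_algebraMap _ (norm_nonneg b) h0).2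
      (sub_le_self _ hpos)
    convert this using 3
    rw [Algebra.algebraMap_eq_smul_one]; simp
  have h1 : ‖f ((‖b‖ : ℂ) • (1 : A) - b)‖ ≤ ‖b‖ := by
    refine (f.le_opNorm _).trans ?_
    rw [hf1, one_mul]; exact hb'
  have h2 := (Complex.re_le_norm _).trans h1
  simp [hf'] at h2
  exact Complex.nonneg_iff.2 ⟨by simpa using h2, by simpa using him.symm⟩

section PseudoMetric

variable {F : ℝ≥0 → ℝ≥0 → ℝ≥0 → ℝ≥0 → ℝ≥0} {G : ℝ≥0 → ℝ≥0 → ℝ≥0 → ℝ≥0} {H : ℝ≥0 → ℝ≥0 → ℝ≥0}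

lemma BundleData.star_ip (Ω : BundleData.{u}) (ω η : Ω.Mod) : star (Ω.ip ω η) = Ω.ip η ω :=
  CStarModule.star_inner _ _

/-- The identity bridge of a metrized quantum vector bundle. -/
noncomputable def ModularBridge.refl (Ω : MetrizedBundle.{u} F G H) : ModularBridge Ω.1 Ω.1 where
  D := Ω.1.Alg
  pivot := 1
  norm_pivot_le := by
    have := Ω.2.base.nontrivial
    simp
  levelSet_nonempty := by
    have := Ω.2.base.nontrivial
    obtain ⟨φ⟩ := exists_state Ω.1.Alg
    exact ⟨φ, by simp [levelSet]⟩
  π₁ := StarAlgHom.id ℂ _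
  π₂ := StarAlgHom.id ℂ _
  injective₁ := fun _ _ h => h
  injective₂ := fun _ _ h => h
  J := {ω : Ω.1.Mod // Ω.1.D ω ≤ 1}
  nonempty := ⟨0, by
    have := Ω.2.smul 0 0
    simp only [smul_zero, enorm_zero, zero_mul] at this
    simp [this]⟩
  anchor := Subtype.val
  coanchor := Subtype.val
  anchor_le := fun j => j.2
  coanchor_le := fun j => j.2

lemma ModularBridge.length_refl (Ω : MetrizedBundle.{u} F G H) :
    (ModularBridge.refl Ω).length = 0 := by
  have hbn : ∀ a : Ω.1.Alg, (ModularBridge.refl Ω).bn a a = 0 := by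
    intro a
    change ‖a * 1 - 1 * a‖ₑ = 0
    simp
  have hmk : haus (mkDist Ω.1.L) Set.univ
      (State.pullback (StarAlgHom.id ℂ Ω.1.Alg) '' levelSet (1 : Ω.1.Alg)) = 0 := by
    have : State.pullback (StarAlgHom.id ℂ Ω.1.Alg) '' levelSet (1 : Ω.1.Alg) = Set.univ := by
      refine Set.eq_univ_of_forall fun φ => ⟨φ, by simp [levelSet], ?_⟩
      rfl
    rw [this]
    exact haus_self_le _ (fun φ => by simp [mkDist]) _
  have hheight : (ModularBridge.refl Ω).height = 0 := by
    rw [ModularBridge.height]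
    exact (max_eq_left le_rfl).trans hmk
  have hbasic : (ModularBridge.refl Ω).basicReach = 0 := haus_self_le
    (fun a b : selfAdjoint Ω.1.Alg => (ModularBridge.refl Ω).bn (a : Ω.1.Alg) (b : Ω.1.Alg))
    (fun a => hbn a) _
  have hmod : (ModularBridge.refl Ω).modularReach = 0 := by
    refine le_antisymm (iSup_le fun j => iSup_le fun k => max_le ?_ ?_) zero_le
    · exact (hbn _).le
    · exact (hbn _).le
  have himp : (ModularBridge.refl Ω).imprint = 0 := by
    have hr : Set.range (Subtype.val : {ω : Ω.1.Mod // Ω.1.D ω ≤ 1} → Ω.1.Mod)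
        = {ω | Ω.1.D ω ≤ 1} := Subtype.range_val
    have h0 : haus Ω.1.modularMK
        (Set.range (Subtype.val : {ω : Ω.1.Mod // Ω.1.D ω ≤ 1} → Ω.1.Mod))
        {ω | Ω.1.D ω ≤ 1} = 0 := by
      rw [hr]
      exact haus_self_le _ (fun ω => by simp [BundleData.modularMK]) _
    rw [ModularBridge.imprint]
    exact (max_eq_left le_rfl).trans h0
  simp [ModularBridge.length, ModularBridge.reach, hheight, hbasic, hmod, himp]

/-- The reversed bridge, with the adjoint pivot. -/
noncomputable def ModularBridge.reverse {Ω₁ Ω₂ : BundleData.{u}} (γ : ModularBridge Ω₁ Ω₂) :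
    ModularBridge Ω₂ Ω₁ where
  D := γ.D
  pivot := star γ.pivot
  norm_pivot_le := by simpa using γ.norm_pivot_le
  levelSet_nonempty := by
    obtain ⟨φ, h₁, h₂⟩ := γ.levelSet_nonempty
    exact ⟨φ, by simpa using h₂, by simpa using h₁⟩
  π₁ := γ.π₂
  π₂ := γ.π₁
  injective₁ := γ.injective₂
  injective₂ := γ.injective₁
  J := γ.J
  nonempty := γ.nonempty
  anchor := γ.coanchor
  coanchor := γ.anchor
  anchor_le := γ.coanchor_le
  coanchor_le := γ.anchor_le

lemma ModularBridge.length_reverse {Ω₁ Ω₂ : BundleData.{u}} (γ : ModularBridge Ω₁ Ω₂) :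
    γ.reverse.length = γ.length := by
  have hbn : ∀ a b, γ.reverse.bn b a = γ.bn (star a) (star b) := by
    intro a b
    change ‖γ.π₂ b * star γ.pivot - star γ.pivot * γ.π₁ a‖ₑ =
      ‖γ.π₁ (star a) * γ.pivot - γ.pivot * γ.π₂ (star b)‖ₑ
    rw [← enorm_neg, ← ofReal_norm, ← ofReal_norm, ← norm_star]
    congr 2
    simp [map_star]
  have hlev : levelSet (star γ.pivot) = levelSet γ.pivot := by
    ext φ
    simp only [levelSet, Set.mem_ofPred_eq, star_sub, star_one, star_star]
    exact and_comm
  have hheight : γ.reverse.height = γ.height := by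
    change max (haus (mkDist Ω₂.L) Set.univ (State.pullback γ.π₂ '' levelSet (star γ.pivot)))
      (haus (mkDist Ω₁.L) Set.univ (State.pullback γ.π₁ '' levelSet (star γ.pivot))) = _
    rw [hlev, max_comm]; rfl
  have hbasic : γ.reverse.basicReach = γ.basicReach := by
    rw [ModularBridge.basicReach, ModularBridge.basicReach, ← haus_swap]
    congr 1
    funext a b
    rw [hbn, a.2.star_eq, b.2.star_eq]
  have hmod : γ.reverse.modularReach = γ.modularReach := by
    refine iSup_congr fun j => iSup_congr fun k => ?_
    rw [max_comm, hbn, hbn]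
    simp only [BundleData.star_ip]
    rfl
  have himp : γ.reverse.imprint = γ.imprint := max_comm _ _
  simp [ModularBridge.length, ModularBridge.reach, hheight, hbasic, hmod, himp]

/-- Concatenation of treks. -/
noncomputable def Trek.append {Ω₁ Ω₂ Ω₃ : MetrizedBundle.{u} F G H} :
    Trek F G H Ω₁ Ω₂ → Trek F G H Ω₂ Ω₃ → Trek F G H Ω₁ Ω₃
  | .single γ, Γ' => .cons γ Γ'
  | .cons γ Γ, Γ' => .cons γ (Γ.append Γ')

lemma Trek.length_append {Ω₁ Ω₂ Ω₃ : MetrizedBundle.{u} F G H} (Γ : Trek F G H Ω₁ Ω₂)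
    (Γ' : Trek F G H Ω₂ Ω₃) : (Γ.append Γ').length = Γ.length + Γ'.length := by
  induction Γ with
  | single γ => simp [Trek.append, Trek.length]
  | cons γ Γ ih => simp [Trek.append, Trek.length, ih, add_assoc]

/-- Reversal of treks. -/
noncomputable def Trek.reverse {Ω₁ Ω₂ : MetrizedBundle.{u} F G H} :
    Trek F G H Ω₁ Ω₂ → Trek F G H Ω₂ Ω₁
  | .single γ => .single γ.reverse
  | .cons γ Γ => Γ.reverse.append (.single γ.reverse)

lemma Trek.length_reverse {Ω₁ Ω₂ : MetrizedBundle.{u} F G H} (Γ : Trek F G H Ω₁ Ω₂) :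
    Γ.reverse.length = Γ.length := by
  induction Γ with
  | single γ => simp [Trek.reverse, Trek.length, ModularBridge.length_reverse]
  | cons γ Γ ih =>
    simp [Trek.reverse, Trek.length, Trek.length_append, ih, ModularBridge.length_reverse, add_comm]

lemma propinquity_comm_le (Ω Ω' : MetrizedBundle.{u} F G H) :
    propinquity Ω Ω' ≤ propinquity Ω' Ω :=
  le_iInf fun Γ => (iInf_le _ Γ.reverse).trans Γ.length_reverse.le

/-- The class of `(F, G, H)`-metrized quantum vector bundles with the distance `Λ^mod`, and hence
with the topology that it induces. -/
noncomputable instance : PseudoEMetricSpace (MetrizedBundle.{u} F G H) where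
  edist := propinquity
  edist_self Ω := le_antisymm
    ((iInf_le _ (Trek.single (ModularBridge.refl Ω))).trans (ModularBridge.length_refl Ω).le)
    zero_le
  edist_comm Ω Ω' := le_antisymm (propinquity_comm_le _ _) (propinquity_comm_le _ _)
  edist_triangle Ω Ω' Ω'' := by
    change _ ≤ (⨅ Γ : Trek F G H Ω Ω', Γ.length) + ⨅ Γ : Trek F G H Ω' Ω'', Γ.length
    simp only [ENNReal.iInf_add, ENNReal.add_iInf]
    exact le_iInf fun Γ' => le_iInf fun Γ => (iInf_le _ (Γ.append Γ')).trans
      (Γ.length_append Γ').le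

end PseudoMetric

/-! ### Ideals and the Fell topology -/

/-- `Ideals(A)`: the norm-closed two-sided ideals of `A`. -/
structure ClosedIdeal (A : Type u) [CStarAlgebra A] : Type u where
  toIdeal : Ideal A
  isTwoSided : toIdeal.IsTwoSided
  isClosed : IsClosed (toIdeal : Set A)

/-- A ⋆-representation on a Hilbert space is irreducible if the space is nonzero and the only
closed invariant subspaces are the trivial ones. -/
def IsIrreducibleRep {A H : Type u} [CStarAlgebra A] [NormedAddCommGroup H] [InnerProductSpace ℂ H]
    [CompleteSpace H] (π : A →⋆ₐ[ℂ] (H →L[ℂ] H)) : Prop :=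
  Nontrivial H ∧ ∀ K : Submodule ℂ H, IsClosed (K : Set H) → (∀ a, ∀ v ∈ K, π a v ∈ K) →
    K = ⊥ ∨ K = ⊤

/-- Primitive ideals: kernels of irreducible ⋆-representations. -/
def IsPrimitiveIdeal {A : Type u} [CStarAlgebra A] (P : Ideal A) : Prop :=
  ∃ (H : Type u) (_ : NormedAddCommGroup H) (_ : InnerProductSpace ℂ H) (_ : CompleteSpace H)
    (π : A →⋆ₐ[ℂ] (H →L[ℂ] H)), IsIrreducibleRep π ∧ ∀ a, a ∈ P ↔ π a = 0

/-- The primitive ideal space of `A`. -/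
def PrimitiveSpectrum (A : Type u) [CStarAlgebra A] : Type u := {P : Ideal A // IsPrimitiveIdeal P}

/-- The hull `{P : I ⊆ P}` of an ideal `I`. -/
def hull {A : Type u} [CStarAlgebra A] (I : ClosedIdeal A) : Set (PrimitiveSpectrum A) :=
  {P | I.toIdeal ≤ P.1}

/-- The Jacobson (hull-kernel) topology, whose closed sets are the hulls of ideals. -/
instance (A : Type u) [CStarAlgebra A] : TopologicalSpace (PrimitiveSpectrum A) :=
  TopologicalSpace.generateFrom {U | ∃ I : ClosedIdeal A, U = (hull I)ᶜ}

/-- The hull of an ideal as a closed subset of the primitive ideal space. -/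
def closedHull {A : Type u} [CStarAlgebra A] (I : ClosedIdeal A) :
    TopologicalSpace.Closeds (PrimitiveSpectrum A) :=
  ⟨hull I, ⟨TopologicalSpace.isOpen_generateFrom_of_mem ⟨I, rfl⟩⟩⟩

/-- The Fell topology on the closed subsets of a topological space `X`, generated by the sets
`{Y : Y ∩ C = ∅}` for `C` compact and `{Y : Y ∩ U ≠ ∅}` for `U` open. -/
@[reducible] def fellTopology (X : Type u) [TopologicalSpace X] :
    TopologicalSpace (TopologicalSpace.Closeds X) :=
  TopologicalSpace.generateFrom
    ({S | ∃ C : Set X, IsCompact C ∧ S = {Y : TopologicalSpace.Closeds X | Disjoint (Y : Set X) C}} ∪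
      {S | ∃ U : Set X, IsOpen U ∧ S = {Y : TopologicalSpace.Closeds X | ((Y : Set X) ∩ U).Nonempty}})

/-- The Fell topology on `Ideals(A)`, transported from the closed subsets of the primitive ideal
space along the canonical correspondence `I ↦ {P : I ⊆ P}`. -/
instance (A : Type u) [CStarAlgebra A] : TopologicalSpace (ClosedIdeal A) :=
  TopologicalSpace.induced closedHull (fellTopology (PrimitiveSpectrum A))

/-! ### Ideals as left Hilbert modules -/

section IdealModule

variable {A : Type u} [CStarAlgebra A] [PartialOrder A] [StarOrderedRing A]

/-- The left Hilbert `A`-module structure `⟨ω, ν⟩ = ω ν⋆` on an ideal of `A`; in the convention of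
`CStarModule`, `inner ν ω = ω ν⋆`. -/
@[reducible] noncomputable def idealCStarModule (I : Ideal A) : CStarModule A I where
  inner ν ω := (ω : A) * star (ν : A)
  inner_add_right := by intros; simp [add_mul]
  inner_self_nonneg := mul_star_self_nonneg _
  inner_self := by intro x; simp
  inner_op_smul_right := by intros; simp [mul_assoc]
  inner_smul_right_complex := by intros; simp
  star_inner := by intros; simp
  norm_eq_sqrt_norm_inner_self x := by
    rw [CStarRing.norm_self_mul_star, Real.sqrt_mul_self (norm_nonneg _)]
    rfl

end IdealModule

/-! ### AF-algebras with a faithful tracial state -/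

section AF

variable {A : Type u} [CStarAlgebra A] [PartialOrder A] [StarOrderedRing A]

/-- `E` is a conditional expectation of `A` onto the subalgebra `B`: a positive contractive linear
projection onto `B` which is a `B`-bimodule map. -/
structure IsConditionalExpectation (B : StarSubalgebra ℂ A) (E : A →ₗ[ℂ] A) : Prop where
  mem : ∀ a, E a ∈ B
  apply_of_mem : ∀ b ∈ B, E b = b
  nonneg : ∀ a, 0 ≤ a → 0 ≤ E a
  norm_le : ∀ a, ‖E a‖ ≤ ‖a‖
  bimodule : ∀ b ∈ B, ∀ c ∈ B, ∀ a, E (b * a * c) = b * E a * c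

/-- The `τ`-preserving conditional expectation onto `B`.  (It exists and is unique when `τ` is a
faithful tracial state and `B` is finite-dimensional.) -/
noncomputable def condExp (τ : State A) (B : StarSubalgebra ℂ A) : A →ₗ[ℂ] A :=
  Classical.epsilon fun E => IsConditionalExpectation B E ∧ ∀ a, τ.1 (E a) = τ.1 a

/-- The unit of the algebra `S` (which is unique if it exists, as it does when `S` is an ideal of a
finite-dimensional C⋆-algebra). -/
noncomputable def unitOf (S : Set A) : A :=
  Classical.epsilon fun e => e ∈ S ∧ ∀ x ∈ S, e * x = x ∧ x * e = x

/-- `L_β(a) = sup_n ‖a - E_n(a)‖ / β(n)`. -/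
noncomputable def afL (𝒜 : ℕ → StarSubalgebra ℂ A) (τ : State A) (β : ℕ → ℝ) (a : A) : ℝ≥0∞ :=
  ⨆ n, ‖a - condExp τ (𝒜 n) a‖ₑ / ENNReal.ofReal (β n)

/-- `D_I(ω) = max {L_β(ω), ‖ω‖, sup_n ‖ω - ω 1_n‖ / β(n)}`, where `1_n` is the unit of
`I_n = I ∩ A_n`. -/
noncomputable def afD (𝒜 : ℕ → StarSubalgebra ℂ A) (τ : State A) (β : ℕ → ℝ) (I : ClosedIdeal A)
    (ω : A) : ℝ≥0∞ :=
  max (max (afL 𝒜 τ β ω) ‖ω‖ₑ)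
    (⨆ n, ‖ω - ω * unitOf ((I.toIdeal : Set A) ∩ (𝒜 n : Set A))‖ₑ / ENNReal.ofReal (β n))

/-- The data `Ω_I^β = (I, ⟨·,·⟩_I, D_I, A, L_β)`. -/
noncomputable def afBundle (𝒜 : ℕ → StarSubalgebra ℂ A) (τ : State A) (β : ℕ → ℝ)
    (I : ClosedIdeal A) : BundleData.{u} :=
  haveI : CompleteSpace I.toIdeal := I.isClosed.completeSpace_coe
  letI := idealCStarModule I.toIdeal
  { Alg := A
    Mod := I.toIdeal
    L := fun a => afL 𝒜 τ β (a : A)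
    D := fun ω => afD 𝒜 τ β I (ω : A) }

end AF

/-- `F(x₁, x₂, x₃, x₄) = 2 (x₁ x₄ + x₂ x₃)`. -/
def afF (x₁ x₂ x₃ x₄ : ℝ≥0) : ℝ≥0 := 2 * (x₁ * x₄ + x₂ * x₃)

/-- `G(x, y, z) = F(x, y, z, z)`. -/
def afG (x y z : ℝ≥0) : ℝ≥0 := afF x y z z

/-- `H(x, y) = F(x, x, y, y)`. -/
def afH (x y : ℝ≥0) : ℝ≥0 := afF x x y y

end ModularPropinquity

open ModularPropinquity

/-!
The base space of every bundle `Ω_I` is `(A, L_β)`, and only the module and its norm `D_I` vary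
with the ideal. Everything is controlled by the finite-dimensional algebras `A_n`.

The conditional expectation `E_n` is the orthogonal projection onto `A_n` for the inner product of
the trace, and the unit `1_n` of `I ∩ A_n` is the orthogonal projection of `1` onto this ideal, a
central projection of `A_n`. The quasi-Leibniz inequalities come from comparing `a b` with
`E_n a * E_n b`. An element of the unit ball of `L_β` is within `β n` of `A_n`; this makes the unit
balls totally bounded (modulo scalars for `L_β`), from which `mk_L` metrizes the weak-⋆ topology and
the unit ball of `D_I` is compact. The domain of `D_I` is dense because `I ∩ ⋃ A_n` is dense in `I`:
the quotient map by `I` is isometric on `A_n (1 - 1_n)`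
(`IsTracialAF.norm_le_norm_sub_of_mul_unitAt`).

Continuity has two halves. First, the Fell topology makes `I ↦ I ∩ A_N` locally constant
(`IsTracialAF.eventually_inter_eq`). Indeed `I ∩ A_N` is generated by one of the finitely many
central projections of `A_N`, and for a projection `p` in `A_N` the conditions `p ∈ I` and `p ∉ I`
are both open: they say that the hull of `I` misses, or meets, the set of primitive ideals not
containing `p`, which is compact and open. This uses that `p ∉ I` is witnessed by a primitive ideal
containing `I` (`IsTracialAF.exists_primitive`), the kernel of the GNS representation of an extreme
point of the compact convex set of states that vanish on `I` and equal `1` at `p`.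

Second, if `I ∩ A_N = I' ∩ A_N`, then `D_I` and `D_{I'}` agree on this intersection, and the bridge
over `A` with pivot `1` and with the unit ball of `D_I` in `I ∩ A_N` as anchors and coanchors has
zero height, basic reach and modular reach. Its imprint is small because `ω` in the unit ball of
`D_I` is close to a multiple of `E_N (ω 1_N)` in that ball
(`IsTracialAF.exists_norm_sub_le_of_afD_le`); how far `D_I (E_N (ω 1_N))` may exceed `1` is governed
by the ratios `β N / β n` for `n < N`, which are uniformly small for suitable `N` because
`β (n + 1) / β n` tends to `0`.
-/

/-! ### States and conditional expectations -/

namespace ModularPropinquity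

section StateFacts

variable {A : Type u} [CStarAlgebra A]

lemma State.nontrivial (φ : State A) : Nontrivial A :=
  ⟨⟨0, 1, fun h01 => zero_ne_one (α := ℂ)
    ((map_zero φ.1).symm.trans ((congrArg φ.1 h01).trans φ.2.2))⟩⟩

lemma State.map_star (φ : State A) (a : A) : φ.1 (star a) = star (φ.1 a) := by
  -- the imaginary part of `φ (b + b⋆)` vanishes, by positivity on `(1 + b)⋆ (1 + b)`
  have key : ∀ b : A, 0 ≤ φ.1 b + φ.1 (star b) + (1 + φ.1 (star b * b)) := fun b => by
    have := φ.2.1 (1 + b)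
    rw [star_add, star_one, add_mul, one_mul, mul_add, mul_one] at this
    simp only [map_add, φ.2.2] at this
    convert this using 1; ring
  have him : ∀ b : A, (φ.1 b + φ.1 (star b)).im = 0 := fun b => by
    have h1 := (Complex.nonneg_iff.1 (key b)).2
    have h2 := (Complex.nonneg_iff.1 (φ.2.1 b)).2
    simp only [Complex.add_im, Complex.one_im] at h1 ⊢
    linarith
  have h1 := him a
  have h2 := him (Complex.I • a)
  simp only [star_smul, map_smul, smul_eq_mul, Complex.add_im, Complex.mul_im, Complex.I_re,
    Complex.I_im, Complex.star_def, Complex.conj_I, Complex.neg_re, Complex.neg_im] at h1 h2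
  apply Complex.ext
  · simp only [Complex.star_def, Complex.conj_re]; linarith
  · simp only [Complex.star_def, Complex.conj_im]; linarith

variable [PartialOrder A] [StarOrderedRing A]

lemma State.map_nonneg (φ : State A) {a : A} (ha : 0 ≤ a) : 0 ≤ φ.1 a := by
  obtain ⟨b, rfl⟩ := CStarAlgebra.nonneg_iff_eq_star_mul_self.1 ha
  exact φ.2.1 b

/-- A state as a positive linear map. -/
noncomputable def State.toPositive (φ : State A) : A →ₚ[ℂ] ℂ :=
  PositiveLinearMap.mk₀ φ.1 fun _ ha => φ.map_nonneg ha

lemma State.norm_apply_le_of_isSelfAdjoint (φ : State A) {a : A} (ha : IsSelfAdjoint a) :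
    ‖φ.1 a‖ ≤ ‖a‖ := by
  have h1 := φ.map_nonneg (sub_nonneg.2 ha.le_algebraMap_norm_self)
  have h2 := φ.map_nonneg (sub_nonneg.2 ha.neg_algebraMap_norm_le_self)
  have h3 : (φ.1 a).im = 0 := by
    have := φ.map_star a
    rw [ha.star_eq] at this
    exact Complex.conj_eq_iff_im.1 this.symm
  have e : φ.1 (algebraMap ℝ A ‖a‖) = (‖a‖ : ℂ) := by
    rw [Algebra.algebraMap_eq_smul_one, ← Complex.coe_smul, map_smul, φ.2.2]; simp
  rw [map_sub, e] at h1
  rw [map_sub, map_neg, e] at h2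
  have h1' := (Complex.nonneg_iff.1 h1).1
  have h2' := (Complex.nonneg_iff.1 h2).1
  simp at h1' h2'
  rw [← Complex.re_add_im (φ.1 a), h3]
  simp [abs_le]
  constructor <;> linarith

/-- States satisfy this without the factor `2`, which comes from splitting `a` into
its real and imaginary parts. -/
lemma State.norm_apply_le (φ : State A) (a : A) : ‖φ.1 a‖ ≤ 2 * ‖a‖ := by
  conv_lhs => rw [← realPart_add_I_smul_imaginaryPart a]
  rw [map_add, map_smul]
  refine (norm_add_le _ _).trans ?_
  have h1 := φ.norm_apply_le_of_isSelfAdjoint (ℜ a).2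
  have h2 := φ.norm_apply_le_of_isSelfAdjoint (ℑ a).2
  have h3 : ‖(ℜ a : A)‖ ≤ ‖a‖ := realPart.norm_le a
  have h4 : ‖(ℑ a : A)‖ ≤ ‖a‖ := imaginaryPart.norm_le a
  rw [norm_smul, Complex.norm_I]
  linarith

/-- Orthogonal projection onto a finite-dimensional subspace for the semi-inner product
`⟨a, b⟩ = φ (a⋆ b)`. -/
lemma State.exists_orthogonal_projection (φ : State A) (V : Submodule ℂ A)
    [FiniteDimensional ℂ V] (a : A) : ∃ b ∈ V, ∀ c ∈ V, φ.1 (star c * (a - b)) = 0 := by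
  let f := φ.toPositive
  let ι : A →ₗ[ℂ] f.GNS :=
    (UniformSpace.Completion.toComplₗᵢ (𝕜 := ℂ) (E := f.PreGNS)).toLinearMap ∘ₗ
      f.toPreGNS.toLinearMap
  have hι : ∀ x y : A, inner ℂ (ι x) (ι y) = φ.1 (star x * y) := fun x y =>
    UniformSpace.Completion.inner_coe (f.toPreGNS x) (f.toPreGNS y)
  let W := V.map ι
  have hW := W.starProjection_apply_mem (ι a)
  obtain ⟨b, hb, hb'⟩ := Submodule.mem_map.1 hW
  refine ⟨b, hb, fun c hc => ?_⟩
  rw [← hι, map_sub, hb']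
  have := W.starProjection_inner_eq_zero (ι a) (ι c) (Submodule.mem_map_of_mem hc)
  rw [← inner_conj_symm, this, map_zero]

end StateFacts

section CondExp

variable {A : Type u} [CStarAlgebra A] [PartialOrder A] [StarOrderedRing A]
  {τ : State A} {B : StarSubalgebra ℂ A}

omit [PartialOrder A] [StarOrderedRing A] in
lemma eq_of_faithful (h_faithful : ∀ a : A, τ.1 (star a * a) = 0 → a = 0) {a b b' : A}
    (hb : b ∈ B) (hb' : b' ∈ B) (h : ∀ c ∈ B, τ.1 (c * b) = τ.1 (c * a))
    (h' : ∀ c ∈ B, τ.1 (c * b') = τ.1 (c * a)) : b = b' := by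
  refine sub_eq_zero.1 (h_faithful _ ?_)
  have hc : star (b - b') ∈ B := star_mem (sub_mem hb hb')
  rw [mul_sub, map_sub, h _ hc, h' _ hc, sub_self]

/-- The conditional expectation is the orthogonal projection for the inner product of the trace; it
is positive because `B` contains the negative part of each of its self-adjoint elements, and
contractive by the Kadison–Schwarz inequality `E a⋆ E a ≤ E (a⋆ a)`. -/
lemma exists_conditionalExpectation [FiniteDimensional ℂ B]
    (h_tracial : ∀ a b : A, τ.1 (a * b) = τ.1 (b * a))
    (h_faithful : ∀ a : A, τ.1 (star a * a) = 0 → a = 0) :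
    ∃ E : A →ₗ[ℂ] A, IsConditionalExpectation B E ∧ ∀ a, τ.1 (E a) = τ.1 a := by
  have hex : ∀ a : A, ∃ b ∈ B, ∀ c ∈ B, τ.1 (c * b) = τ.1 (c * a) := fun a => by
    have : FiniteDimensional ℂ (Subalgebra.toSubmodule B.toSubalgebra) := ‹_›
    obtain ⟨b, hb, h⟩ := τ.exists_orthogonal_projection (Subalgebra.toSubmodule B.toSubalgebra) a
    refine ⟨b, hb, fun c hc => ?_⟩
    have := h (star c) (star_mem (S := StarSubalgebra ℂ A) (s := B) hc)
    rw [star_star, mul_sub, map_sub, sub_eq_zero] at this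
    exact this.symm
  choose E hE hEc using hex
  have uniq : ∀ {a b : A}, b ∈ B → (∀ c ∈ B, τ.1 (c * b) = τ.1 (c * a)) → E a = b :=
    fun hb h => eq_of_faithful h_faithful (hE _) hb (hEc _) h
  let E' : A →ₗ[ℂ] A :=
    { toFun := E
      map_add' := fun a b => uniq (add_mem (hE a) (hE b)) fun c hc => by
        simp only [mul_add, map_add, hEc _ c hc]
      map_smul' := fun t a => uniq (SMulMemClass.smul_mem t (hE a)) fun c hc => by
        simp only [mul_smul_comm, map_smul, hEc _ c hc, RingHom.id_apply] }
  have hstar : ∀ a, E (star a) = star (E a) := fun a => uniq (star_mem (hE a)) fun c hc => by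
    have := hEc a (star c) (star_mem hc)
    rw [← star_inj, ← τ.map_star, ← τ.map_star] at this
    simp only [star_mul, star_star] at this
    rw [h_tracial, this, h_tracial]
  have hbi : ∀ b ∈ B, ∀ c ∈ B, ∀ a, E (b * a * c) = b * E a * c := fun b hb c hc a =>
    uniq (mul_mem (mul_mem hb (hE a)) hc) fun d hd => by
      have e : ∀ x : A, τ.1 (d * (b * x * c)) = τ.1 (c * d * b * x) := fun x => by
        rw [← mul_assoc, ← mul_assoc, h_tracial]; simp only [mul_assoc]
      rw [e, e]
      exact hEc a _ (mul_mem (mul_mem hc hd) hb)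
  have hfix : ∀ b ∈ B, E b = b := fun b hb => uniq hb fun _ _ => rfl
  have hclosed : IsClosed (B : Set A) :=
    Submodule.closed_of_finiteDimensional (Subalgebra.toSubmodule B.toSubalgebra)
  have hnonneg : ∀ a, 0 ≤ a → 0 ≤ E a := fun a ha => by
    have hsa : IsSelfAdjoint (E a) := by
      rw [IsSelfAdjoint, ← hstar, (IsSelfAdjoint.of_nonneg ha).star_eq]
    -- `τ ((E a)⁻ a) = τ ((E a)⁻ E a) = -τ ((E a)⁻ (E a)⁻)`, with a nonnegative left-hand side
    have hn : (E a)⁻ ∈ B := by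
      have : IsClosed (B : Set A) := hclosed
      exact cfcₙ_mem (𝕜' := ℂ) _ (hE a)
    have h1 : τ.1 ((E a)⁻ * E a) = - τ.1 (star (E a)⁻ * (E a)⁻) := by
      rw [(IsSelfAdjoint.of_nonneg (CFC.negPart_nonneg (E a))).star_eq, ← map_neg]
      congr 1
      calc (E a)⁻ * E a = (E a)⁻ * ((E a)⁺ - (E a)⁻) := by
            rw [CFC.posPart_sub_negPart (E a) hsa]
        _ = _ := by rw [mul_sub, CFC.negPart_mul_posPart, zero_sub]
    have h2 : 0 ≤ τ.1 ((E a)⁻ * a) := by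
      obtain ⟨s, hs⟩ := CStarAlgebra.nonneg_iff_eq_star_mul_self.1 (CFC.negPart_nonneg (E a))
      obtain ⟨r, hr⟩ := CStarAlgebra.nonneg_iff_eq_star_mul_self.1 ha
      rw [hs, hr, mul_assoc, h_tracial]
      convert τ.2.1 (r * star s) using 2
      simp [mul_assoc]
    rw [← hEc a _ hn, h1] at h2
    have h3 : τ.1 (star (E a)⁻ * (E a)⁻) = 0 :=
      le_antisymm (neg_nonneg.1 h2) (τ.2.1 _)
    exact (CFC.negPart_eq_zero_iff _ hsa).1 (h_faithful _ h3)
  refine ⟨E', ⟨hE, hfix, hnonneg, fun a => ?_, hbi⟩, fun a => by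
    have := hEc a 1 (one_mem B)
    rwa [one_mul, one_mul] at this⟩
  change ‖E a‖ ≤ ‖a‖
  have hsub : ∀ x y, E (x - y) = E x - E y := fun x y => map_sub E' x y
  have hmono : ∀ x y, x ≤ y → E x ≤ E y := fun x y h => by
    have := hnonneg _ (sub_nonneg.2 h)
    rwa [hsub, sub_nonneg] at this
  -- Kadison–Schwarz: expand `0 ≤ E ((a - E a)⋆ (a - E a))`
  have h1 : 0 ≤ E (star a * a) - star (E a) * E a := by
    have h := hnonneg _ (star_mul_self_nonneg (a - E a))
    have e : star (a - E a) * (a - E a)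
        = star a * a - star a * E a - star (E a) * a + star (E a) * E a := by
      rw [star_sub]; noncomm_ring
    have e1 : E (star a * E a) = star (E a) * E a := by
      have := hbi 1 (one_mem B) (E a) (hE a) (star a)
      simpa [hstar] using this
    have e2 : E (star (E a) * a) = star (E a) * E a := by
      have := hbi (star (E a)) (star_mem (hE a)) 1 (one_mem B) a
      simpa using this
    have e3 : E (star (E a) * E a) = star (E a) * E a :=
      hfix _ (mul_mem (star_mem (hE a)) (hE a))
    have hadd : ∀ x y, E (x + y) = E x + E y := fun x y => map_add E' x y
    rw [e, hadd, hsub, hsub, e1, e2, e3] at h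
    convert h using 1; abel
  have h2 : E (star a * a) ≤ algebraMap ℝ A (‖a‖ * ‖a‖) := by
    rw [← CStarRing.norm_star_mul_self]
    refine (hmono _ _ (IsSelfAdjoint.star_mul_self a).le_algebraMap_norm_self).trans_eq ?_
    refine hfix _ ?_
    rw [IsScalarTower.algebraMap_apply ℝ ℂ A]
    exact algebraMap_mem B _
  have h3 := (CStarAlgebra.norm_le_iff_le_algebraMap (star (E a) * E a)
    (mul_self_nonneg ‖a‖) (star_mul_self_nonneg _)).2 ((sub_nonneg.1 h1).trans h2)
  rw [CStarRing.norm_star_mul_self] at h3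
  exact (mul_self_le_mul_self_iff (norm_nonneg _) (norm_nonneg _)).2 h3

end CondExp

section AF

variable {A : Type u} [CStarAlgebra A] [PartialOrder A] [StarOrderedRing A]

/-- `𝒜` is an increasing sequence of finite-dimensional unital C⋆-subalgebras, starting with the
scalars and with dense union, and `τ` is a faithful tracial state. -/
structure IsTracialAF (𝒜 : ℕ → StarSubalgebra ℂ A) (τ : State A) : Prop where
  mono : Monotone 𝒜
  zero : 𝒜 0 = ⊥
  fin : ∀ n, FiniteDimensional ℂ (𝒜 n)
  dense : Dense (⋃ n, (𝒜 n : Set A))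
  tracial : ∀ a b : A, τ.1 (a * b) = τ.1 (b * a)
  faithful : ∀ a : A, τ.1 (star a * a) = 0 → a = 0

namespace IsTracialAF

variable {𝒜 : ℕ → StarSubalgebra ℂ A} {τ : State A} (h : IsTracialAF 𝒜 τ)
include h

lemma condExp_spec (n : ℕ) : IsConditionalExpectation (𝒜 n) (condExp τ (𝒜 n)) ∧
    ∀ a, τ.1 (condExp τ (𝒜 n) a) = τ.1 a :=
  have := h.fin n
  Classical.epsilon_spec (exists_conditionalExpectation h.tracial h.faithful)

lemma isConditionalExpectation (n : ℕ) :
    IsConditionalExpectation (𝒜 n) (condExp τ (𝒜 n)) := (h.condExp_spec n).1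

lemma condExp_mem (n : ℕ) (a : A) : condExp τ (𝒜 n) a ∈ 𝒜 n :=
  (h.isConditionalExpectation n).mem a

lemma condExp_of_mem {n : ℕ} {a : A} (ha : a ∈ 𝒜 n) : condExp τ (𝒜 n) a = a :=
  (h.isConditionalExpectation n).apply_of_mem a ha

lemma norm_condExp_le (n : ℕ) (a : A) : ‖condExp τ (𝒜 n) a‖ ≤ ‖a‖ :=
  (h.isConditionalExpectation n).norm_le a

lemma continuous_condExp (n : ℕ) : Continuous (condExp τ (𝒜 n)) :=
  ((condExp τ (𝒜 n)).mkContinuous 1 fun a => by simpa using h.norm_condExp_le n a).continuous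

lemma condExp_mul_left {n : ℕ} {b : A} (hb : b ∈ 𝒜 n) (a : A) :
    condExp τ (𝒜 n) (b * a) = b * condExp τ (𝒜 n) a := by
  simpa using (h.isConditionalExpectation n).bimodule b hb 1 (one_mem _) a

lemma condExp_mul_right {n : ℕ} {b : A} (hb : b ∈ 𝒜 n) (a : A) :
    condExp τ (𝒜 n) (a * b) = condExp τ (𝒜 n) a * b := by
  simpa using (h.isConditionalExpectation n).bimodule 1 (one_mem _) b hb a

lemma trace_mul_condExp {n : ℕ} {c : A} (hc : c ∈ 𝒜 n) (a : A) :
    τ.1 (c * condExp τ (𝒜 n) a) = τ.1 (c * a) := by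
  rw [← h.condExp_mul_left hc, (h.condExp_spec n).2]

lemma condExp_eq {n : ℕ} {a b : A} (hb : b ∈ 𝒜 n) (hc : ∀ c ∈ 𝒜 n, τ.1 (c * b) = τ.1 (c * a)) :
    condExp τ (𝒜 n) a = b :=
  eq_of_faithful h.faithful (h.condExp_mem n a) hb (fun _ hc => h.trace_mul_condExp hc a) hc

lemma condExp_star (n : ℕ) (a : A) :
    condExp τ (𝒜 n) (star a) = star (condExp τ (𝒜 n) a) :=
  h.condExp_eq (star_mem (h.condExp_mem n a)) fun c hc => by
    have := h.trace_mul_condExp (star_mem hc) a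
    rw [← star_inj, ← τ.map_star, ← τ.map_star] at this
    simp only [star_mul, star_star] at this
    rw [h.tracial, this, h.tracial]

lemma condExp_condExp {m n : ℕ} (hmn : m ≤ n) (a : A) :
    condExp τ (𝒜 m) (condExp τ (𝒜 n) a) = condExp τ (𝒜 m) a :=
  (h.condExp_eq (h.condExp_mem m _) fun c hc => by
    rw [h.trace_mul_condExp hc, h.trace_mul_condExp (h.mono hmn hc)]).symm

lemma condExp_zero (a : A) : condExp τ (𝒜 0) a = τ.1 a • (1 : A) := by
  refine h.condExp_eq (SMulMemClass.smul_mem _ (one_mem _)) fun c hc => ?_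
  rw [h.zero, StarSubalgebra.mem_bot] at hc
  obtain ⟨t, rfl⟩ := hc
  simp [Algebra.algebraMap_eq_smul_one, τ.2.2, mul_comm]

/-- The quasi-Leibniz inequality comes from comparing `a b` with `E a * E b`, which `E` fixes. -/
lemma norm_mul_sub_condExp_le (n : ℕ) (a b : A) :
    ‖a * b - condExp τ (𝒜 n) (a * b)‖ ≤
      2 * (‖a‖ * ‖b - condExp τ (𝒜 n) b‖ + ‖b‖ * ‖a - condExp τ (𝒜 n) a‖) := by
  set E := condExp τ (𝒜 n)
  have hE : E (E a * E b) = E a * E b :=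
    h.condExp_of_mem (mul_mem (h.condExp_mem n a) (h.condExp_mem n b))
  have h1 : ‖a * b - E a * E b‖ ≤ ‖a‖ * ‖b - E b‖ + ‖b‖ * ‖a - E a‖ := by
    have : a * b - E a * E b = a * (b - E b) + (a - E a) * E b := by noncomm_ring
    rw [this]
    refine (norm_add_le _ _).trans (add_le_add (norm_mul_le _ _) ((norm_mul_le _ _).trans ?_))
    rw [mul_comm]
    gcongr
    exact h.norm_condExp_le n b
  have h2 : a * b - E (a * b) = (a * b - E a * E b) - E (a * b - E a * E b) := by
    rw [map_sub, hE]; abel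
  rw [h2]
  refine (norm_sub_le _ _).trans ?_
  have := h.norm_condExp_le n (a * b - E a * E b)
  linarith

end IsTracialAF
end AF
end ModularPropinquity

/-! ### Units of the ideals `I ∩ A_n` -/

namespace ModularPropinquity

attribute [instance] ClosedIdeal.isTwoSided

section ClosedIdeals

variable {A : Type u} [CStarAlgebra A]

lemma pow_sub_pow_mem {I : Ideal A} [I.IsTwoSided] {x y : A} (h : x - y ∈ I) (m : ℕ) :
    x ^ m - y ^ m ∈ I := by
  induction m with
  | zero => simp
  | succ m ih =>
    have : x ^ (m + 1) - y ^ (m + 1) = x ^ m * (x - y) + (x ^ m - y ^ m) * y := by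
      rw [pow_succ, pow_succ]; noncomm_ring
    rw [this]
    exact add_mem (I.mul_mem_left _ h) (I.mul_mem_right _ ih)

/-- An idempotent at distance less than `1` from a closed ideal belongs to it: the powers of its
difference with an element of the ideal tend to `0` and are congruent to it. -/
lemma ClosedIdeal.mem_of_norm_sub_lt_one (I : ClosedIdeal A) {p i : A} (hp : IsIdempotentElem p)
    (hi : i ∈ I.toIdeal) (h : ‖p - i‖ < 1) : p ∈ I.toIdeal := by
  have h1 : Filter.Tendsto (fun m : ℕ => p - (p - i) ^ (m + 1)) Filter.atTop (𝓝 (p - 0)) :=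
    tendsto_const_nhds.sub
      ((tendsto_pow_atTop_nhds_zero_of_norm_lt_one h).comp (Filter.tendsto_add_atTop_nat 1))
  rw [sub_zero] at h1
  refine I.isClosed.mem_of_tendsto h1 (Filter.Eventually.of_forall fun m => ?_)
  have h2 : p ^ (m + 1) - (p - i) ^ (m + 1) ∈ I.toIdeal :=
    pow_sub_pow_mem (by simpa using hi) _
  rwa [hp.pow_succ_eq] at h2

end ClosedIdeals

namespace IsTracialAF

variable {A : Type u} [CStarAlgebra A] [PartialOrder A] [StarOrderedRing A]
  {𝒜 : ℕ → StarSubalgebra ℂ A} {τ : State A}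

omit [PartialOrder A] [StarOrderedRing A] in
lemma isCompact_ball (h : IsTracialAF 𝒜 τ) (n : ℕ) (r : ℝ) :
    IsCompact {x : A | x ∈ 𝒜 n ∧ ‖x‖ ≤ r} := by
  have : FiniteDimensional ℂ (𝒜 n) := h.fin n
  have : ProperSpace (𝒜 n) := FiniteDimensional.proper ℂ (𝒜 n)
  convert (isCompact_closedBall (0 : 𝒜 n) r).image continuous_subtype_val
  ext x
  simp [and_comm]

/-- The unit `e` is the orthogonal projection of `1` onto the ideal. For `x` in the ideal, both
`(1 - e) x x⋆` and `x⋆ x (1 - e)` lie in the ideal, hence are orthogonal to `1 - e`; by the trace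
property this says that `(1 - e) x` and `x (1 - e)` have norm zero for the trace. -/
lemma exists_unit (h : IsTracialAF 𝒜 τ) (I : ClosedIdeal A) (n : ℕ) :
    ∃ e, e ∈ (I.toIdeal : Set A) ∩ 𝒜 n ∧
      ∀ x ∈ (I.toIdeal : Set A) ∩ 𝒜 n, e * x = x ∧ x * e = x := by
  have : FiniteDimensional ℂ (Subalgebra.toSubmodule (𝒜 n).toSubalgebra) := h.fin n
  let V : Submodule ℂ A := I.toIdeal.restrictScalars ℂ ⊓ Subalgebra.toSubmodule (𝒜 n).toSubalgebra
  have : FiniteDimensional ℂ V := Submodule.finiteDimensional_inf_right _ _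
  obtain ⟨e, he, horth⟩ := τ.exists_orthogonal_projection V 1
  have heA : e ∈ 𝒜 n := he.2
  refine ⟨e, ⟨he.1, heA⟩, fun x hx => ?_⟩
  have hxA : x ∈ 𝒜 n := hx.2
  have h1 : (1 - e) ∈ 𝒜 n := sub_mem (one_mem _) heA
  constructor
  · have hV : (1 - e) * (x * star x) ∈ V :=
      ⟨I.toIdeal.mul_mem_left _ (I.toIdeal.mul_mem_right _ hx.1),
        show _ ∈ 𝒜 n from mul_mem h1 (mul_mem hxA (star_mem hxA))⟩
    have h2 := horth _ hV
    have h3 : (1 - e) * x = 0 := by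
      refine h.faithful _ (Eq.trans ?_ h2)
      rw [← mul_assoc, h.tracial]
      simp only [star_mul, star_star, mul_assoc]
    rw [sub_mul, one_mul, sub_eq_zero] at h3
    exact h3.symm
  · have hV : star x * x * (1 - e) ∈ V :=
      ⟨I.toIdeal.mul_mem_right _ (I.toIdeal.mul_mem_left _ hx.1),
        show _ ∈ 𝒜 n from mul_mem (mul_mem (star_mem hxA) hxA) h1⟩
    have h2 := horth _ hV
    have h3 : x * (1 - e) = 0 := by
      refine h.faithful _ (Eq.trans ?_ h2)
      simp only [star_mul, star_star, mul_assoc]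
    rw [mul_sub, mul_one, sub_eq_zero] at h3
    exact h3.symm

end IsTracialAF

section Units

variable {A : Type u} [CStarAlgebra A] [PartialOrder A] [StarOrderedRing A]

/-- The unit of `I ∩ A_n`. -/
noncomputable abbrev unitAt (𝒜 : ℕ → StarSubalgebra ℂ A) (I : ClosedIdeal A) (n : ℕ) : A :=
  unitOf ((I.toIdeal : Set A) ∩ (𝒜 n : Set A))

namespace IsTracialAF

variable {𝒜 : ℕ → StarSubalgebra ℂ A} {τ : State A} (h : IsTracialAF 𝒜 τ) (I : ClosedIdeal A)
include h

lemma unitAt_spec (n : ℕ) : unitAt 𝒜 I n ∈ (I.toIdeal : Set A) ∩ 𝒜 n ∧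
    ∀ x ∈ (I.toIdeal : Set A) ∩ 𝒜 n, unitAt 𝒜 I n * x = x ∧ x * unitAt 𝒜 I n = x :=
  Classical.epsilon_spec (h.exists_unit I n)

lemma unitAt_mem_ideal (n : ℕ) : unitAt 𝒜 I n ∈ I.toIdeal := (h.unitAt_spec I n).1.1

lemma unitAt_mem (n : ℕ) : unitAt 𝒜 I n ∈ 𝒜 n := (h.unitAt_spec I n).1.2

lemma unitAt_mul {n : ℕ} {x : A} (hx : x ∈ I.toIdeal) (hx' : x ∈ 𝒜 n) : unitAt 𝒜 I n * x = x :=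
  ((h.unitAt_spec I n).2 x ⟨hx, hx'⟩).1

lemma mul_unitAt {n : ℕ} {x : A} (hx : x ∈ I.toIdeal) (hx' : x ∈ 𝒜 n) : x * unitAt 𝒜 I n = x :=
  ((h.unitAt_spec I n).2 x ⟨hx, hx'⟩).2

lemma unitAt_mul_unitAt {m n : ℕ} (hmn : m ≤ n) :
    unitAt 𝒜 I n * unitAt 𝒜 I m = unitAt 𝒜 I m :=
  h.unitAt_mul I (h.unitAt_mem_ideal I m) (h.mono hmn (h.unitAt_mem I m))

lemma unitAt_comm {n : ℕ} {b : A} (hb : b ∈ 𝒜 n) : unitAt 𝒜 I n * b = b * unitAt 𝒜 I n := by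
  have h1 := h.unitAt_mul I (I.toIdeal.mul_mem_left b (h.unitAt_mem_ideal I n))
    (mul_mem hb (h.unitAt_mem I n))
  have h2 := h.mul_unitAt I (I.toIdeal.mul_mem_right b (h.unitAt_mem_ideal I n))
    (mul_mem (h.unitAt_mem I n) hb)
  rw [← h1, ← h2]; simp only [mul_assoc]

lemma isIdempotentElem_unitAt (n : ℕ) : IsIdempotentElem (unitAt 𝒜 I n) :=
  h.unitAt_mul_unitAt I le_rfl

lemma isStarProjection_unitAt (n : ℕ) : IsStarProjection (unitAt 𝒜 I n) := by
  set e := unitAt 𝒜 I n with he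
  have hid : e * e = e := h.isIdempotentElem_unitAt I n
  have heA : e ∈ 𝒜 n := h.unitAt_mem I n
  refine ⟨hid, ?_⟩
  -- `f = e (1 - e⋆)` satisfies `f f⋆ = 0`, since `e` is central in `A_n`
  have h1 : e * (1 - star e) = 0 := by
    rw [← CStarRing.mul_star_self_eq_zero_iff]
    have hc : e * (1 - star e) = (1 - star e) * e :=
      h.unitAt_comm I (sub_mem (one_mem _) (star_mem heA))
    rw [hc]
    simp only [star_mul, star_sub, star_one, star_star]
    have : e * (star e * (1 - e)) = star e * (e * (1 - e)) := by
      rw [← mul_assoc, h.unitAt_comm I (star_mem heA), mul_assoc]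
    rw [mul_assoc, this, mul_sub e, hid, mul_one, sub_self, mul_zero, mul_zero]
  rw [mul_sub, mul_one, sub_eq_zero] at h1
  rw [IsSelfAdjoint, h1, star_mul, star_star]

lemma norm_mul_unitAt_le (n : ℕ) (a : A) : ‖a * unitAt 𝒜 I n‖ ≤ ‖a‖ := by
  refine (norm_mul_le _ _).trans (mul_le_of_le_one_right (norm_nonneg _) ?_)
  exact (h.isStarProjection_unitAt I n).norm_le

/-- The quotient map by `I` is isometric on the self-adjoint part of `A_n (1 - 1_n)`.  If
`‖y - i‖ < ‖y‖ = 1` with `i ∈ I`, then the powers `y ^ (2 ^ k)`, which have norm `1`, approach `I`;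
a limit point of them in the finite-dimensional algebra `A_n` is a unit vector of
`I ∩ A_n (1 - 1_n) = 0`. -/
lemma norm_le_norm_sub_of_mul_unitAt {n : ℕ} {y i : A} (hy : y ∈ 𝒜 n) (hsa : IsSelfAdjoint y)
    (hye : y * unitAt 𝒜 I n = 0) (hi : i ∈ I.toIdeal) : ‖y‖ ≤ ‖y - i‖ := by
  by_contra! hlt
  have hpos : 0 < ‖y‖ := (norm_nonneg _).trans_lt hlt
  set c : ℂ := ((‖y‖⁻¹ : ℝ) : ℂ) with hc
  have hcn : ‖c‖ = ‖y‖⁻¹ := by rw [hc, Complex.norm_real]; simp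
  set z := c • y
  have hz : z ∈ 𝒜 n := SMulMemClass.smul_mem c hy
  have hzsa : IsSelfAdjoint z := by
    rw [IsSelfAdjoint, star_smul, hsa.star_eq, hc, Complex.star_def, Complex.conj_ofReal]
  have hz1 : ‖z‖ = 1 := by rw [norm_smul, hcn, inv_mul_cancel₀ hpos.ne']
  have hj : c • i ∈ I.toIdeal := (I.toIdeal.restrictScalars ℂ).smul_mem c hi
  have hlt1 : ‖z - c • i‖ < 1 := by
    rw [← smul_sub, norm_smul, hcn, inv_mul_lt_iff₀ hpos, mul_one]; exact hlt
  have hpow : ∀ k : ℕ, ‖z ^ 2 ^ k‖ = 1 := fun k => by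
    have := hzsa.nnnorm_pow_two_pow k
    rw [← coe_nnnorm, this, NNReal.coe_pow, coe_nnnorm, hz1, one_pow]
  obtain ⟨q, ⟨hqA, -⟩, φ, hφ, hlim⟩ := (h.isCompact_ball n 1).tendsto_subseq
    (x := fun k => z ^ 2 ^ k) fun k => ⟨pow_mem hz _, (hpow k).le⟩
  have hq1 : ‖q‖ = 1 := tendsto_nhds_unique hlim.norm (by simp [hpow])
  have hqI : q ∈ I.toIdeal := by
    have h0 : Filter.Tendsto (fun k => (z - c • i) ^ 2 ^ φ k) Filter.atTop (𝓝 0) :=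
      (tendsto_pow_atTop_nhds_zero_of_norm_lt_one hlt1).comp
        ((tendsto_pow_atTop_atTop_of_one_lt one_lt_two).comp hφ.tendsto_atTop)
    have h1 := hlim.sub h0
    rw [sub_zero] at h1
    exact I.isClosed.mem_of_tendsto h1
      (Filter.Eventually.of_forall fun k => pow_sub_pow_mem (by simpa using hj) _)
  have hqe : q * unitAt 𝒜 I n = 0 := by
    refine tendsto_nhds_unique (hlim.mul_const _) ?_
    refine tendsto_const_nhds.congr fun k => ?_
    obtain ⟨m, hm⟩ := Nat.exists_eq_succ_of_ne_zero (pow_ne_zero (φ k) two_ne_zero)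
    simp [hm, pow_succ, mul_assoc, z, hye]
  rw [h.mul_unitAt I hqI hqA] at hqe
  simp [hqe] at hq1

/-- The part of `b` outside `I ∩ A_n` is no longer than the distance from `b` to `I`, by the
C⋆-identity and `norm_le_norm_sub_of_mul_unitAt`. -/
lemma norm_sub_mul_unitAt_le {n : ℕ} {a b : A} (hb : b ∈ 𝒜 n) (ha : a ∈ I.toIdeal) :
    ‖b - b * unitAt 𝒜 I n‖ ≤ ‖b - a‖ := by
  set e := unitAt 𝒜 I n
  set x := b - b * e with hx
  have hxA : x ∈ 𝒜 n := sub_mem hb (mul_mem hb (h.unitAt_mem I n))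
  have hxe : x * e = 0 := by
    rw [hx, sub_mul, mul_assoc, h.isIdempotentElem_unitAt I n, sub_self]
  have h1 := h.norm_le_norm_sub_of_mul_unitAt I (mul_mem (star_mem hxA) hxA)
    (IsSelfAdjoint.star_mul_self x) (by rw [mul_assoc, hxe, mul_zero])
    (I.toIdeal.mul_mem_left (star x)
      (sub_mem ha (I.toIdeal.mul_mem_left b (h.unitAt_mem_ideal I n))))
  have h2 : star x * x - star x * (a - b * e) = star x * (b - a) := by
    rw [hx]; noncomm_ring
  rw [h2, CStarRing.norm_star_mul_self] at h1
  have h3 := h1.trans (norm_mul_le _ _)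
  rw [norm_star] at h3
  rcases (norm_nonneg x).eq_or_lt with h0 | h0
  · rw [← h0]; exact norm_nonneg _
  · exact le_of_mul_le_mul_left h3 h0

/-- `I ∩ ⋃ A_n` is dense in `I`: if `b` in `A_n` is close to `a`, then so is `b 1_n`. -/
lemma exists_mem_ideal_norm_sub_lt {a : A} (ha : a ∈ I.toIdeal) {ε : ℝ} (hε : 0 < ε) :
    ∃ n, ∃ b ∈ 𝒜 n, b ∈ I.toIdeal ∧ ‖a - b‖ < ε := by
  obtain ⟨b, hb, hab⟩ := Metric.dense_iff.1 h.dense a (ε / 2) (half_pos hε)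
  obtain ⟨n, hn⟩ := Set.mem_iUnion.1 hab
  rw [Metric.mem_ball, dist_eq_norm] at hb
  refine ⟨n, b * unitAt 𝒜 I n, mul_mem hn (h.unitAt_mem I n),
    I.toIdeal.mul_mem_left b (h.unitAt_mem_ideal I n), ?_⟩
  have h1 := h.norm_sub_mul_unitAt_le I hn ha
  have h2 : a - b * unitAt 𝒜 I n = (b - b * unitAt 𝒜 I n) - (b - a) := by abel
  rw [h2]
  linarith [norm_sub_le (b - b * unitAt 𝒜 I n) (b - a)]

end IsTracialAF
end Units
end ModularPropinquity

/-! ### The quantum compact metric space `(A, L_β)` -/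

namespace ModularPropinquity

section SupSeminorm

variable {E F : Type*} [AddCommGroup E] [Module ℂ E] [NormedAddCommGroup F] [NormedSpace ℂ F]

lemma iSup_enorm_div_add_le (T : ℕ → E →ₗ[ℂ] F) (c : ℕ → ℝ≥0∞) (x y : E) :
    ⨆ n, ‖T n (x + y)‖ₑ / c n ≤ (⨆ n, ‖T n x‖ₑ / c n) + ⨆ n, ‖T n y‖ₑ / c n := by
  refine iSup_le fun n => ?_
  refine le_trans ?_ (add_le_add (le_iSup (fun n => ‖T n x‖ₑ / c n) n)
    (le_iSup (fun n => ‖T n y‖ₑ / c n) n))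
  rw [← ENNReal.add_div, map_add]
  gcongr
  exact enorm_add_le _ _

lemma iSup_enorm_div_smul (T : ℕ → E →ₗ[ℂ] F) (c : ℕ → ℝ≥0∞) (t : ℂ) (x : E) :
    ⨆ n, ‖T n (t • x)‖ₑ / c n = ‖t‖ₑ * ⨆ n, ‖T n x‖ₑ / c n := by
  rw [ENNReal.mul_iSup]
  refine iSup_congr fun n => ?_
  rw [map_smul, enorm_smul, mul_div_assoc]

omit [NormedSpace ℂ F] in
lemma enorm_div_ofReal_le_iff {b : ℝ} (hb : 0 < b) {x : F} {r : ℝ≥0} :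
    ‖x‖ₑ / ENNReal.ofReal b ≤ r ↔ ‖x‖ ≤ r * b := by
  rw [ENNReal.div_le_iff (by simpa using hb) ENNReal.ofReal_ne_top, ← ofReal_norm,
    ← ENNReal.ofReal_coe_nnreal, ← ENNReal.ofReal_mul r.coe_nonneg,
    ENNReal.ofReal_le_ofReal_iff (by positivity)]

/-- A sequence that vanishes eventually is dominated by a multiple of any positive sequence. -/
lemma exists_le_mul_of_eventually_zero {f β : ℕ → ℝ} (hf : ∀ n, 0 ≤ f n) (hβ : ∀ n, 0 < β n)
    {N : ℕ} (h0 : ∀ n, N ≤ n → f n = 0) : ∃ r : ℝ≥0, ∀ n, f n ≤ r * β n := by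
  have hs : ∀ n, 0 ≤ f n / β n := fun n => div_nonneg (hf n) (hβ n).le
  refine ⟨⟨∑ n ∈ Finset.range N, f n / β n, Finset.sum_nonneg fun n _ => hs n⟩, fun n => ?_⟩
  rw [← div_le_iff₀ (hβ n)]
  by_cases hn : n < N
  · exact Finset.single_le_sum (f := fun n => f n / β n) (fun n _ => hs n) (Finset.mem_range.2 hn)
  · rw [h0 n (not_lt.1 hn), zero_div]
    exact NNReal.coe_nonneg _

end SupSeminorm

namespace IsTracialAF

variable {A : Type u} [CStarAlgebra A] [PartialOrder A] [StarOrderedRing A]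
  {𝒜 : ℕ → StarSubalgebra ℂ A} {τ : State A}

section Lip

variable {β : ℕ → ℝ}

omit [StarOrderedRing A] in
lemma afL_add_le (a b : A) : afL 𝒜 τ β (a + b) ≤ afL 𝒜 τ β a + afL 𝒜 τ β b := by
  have := iSup_enorm_div_add_le (fun n => LinearMap.id - condExp τ (𝒜 n))
    (fun n => ENNReal.ofReal (β n)) a b
  simpa only [afL, LinearMap.sub_apply, LinearMap.id_apply] using this

omit [StarOrderedRing A] in
lemma afL_smul (t : ℂ) (a : A) : afL 𝒜 τ β (t • a) = ‖t‖ₑ * afL 𝒜 τ β a := by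
  have := iSup_enorm_div_smul (fun n => LinearMap.id - condExp τ (𝒜 n))
    (fun n => ENNReal.ofReal (β n)) t a
  simpa only [afL, LinearMap.sub_apply, LinearMap.id_apply] using this

lemma afL_star (h : IsTracialAF 𝒜 τ) (a : A) : afL 𝒜 τ β (star a) = afL 𝒜 τ β a := by
  refine iSup_congr fun n => ?_
  rw [h.condExp_star, ← star_sub, ← ofReal_norm, norm_star, ofReal_norm]

lemma afL_realPart_le (h : IsTracialAF 𝒜 τ) (a : A) :
    afL 𝒜 τ β (ℜ a : A) ≤ afL 𝒜 τ β a := by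
  have e : (ℜ a : A) = (2⁻¹ : ℂ) • (a + star a) := by
    rw [realPart_apply_coe, ← Complex.coe_smul]; simp
  have e2 : ‖(2⁻¹ : ℂ)‖ₑ = 2⁻¹ := by
    rw [← ofReal_norm, norm_inv, Complex.norm_ofNat, ENNReal.ofReal_inv_of_pos two_pos]; simp
  rw [e, afL_smul, e2]
  calc _ ≤ 2⁻¹ * (afL 𝒜 τ β a + afL 𝒜 τ β (star a)) := by gcongr; exact afL_add_le _ _
    _ = _ := by
      rw [afL_star h, ← two_mul, ← mul_assoc, ENNReal.inv_mul_cancel two_ne_zero ENNReal.ofNat_ne_top,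
        one_mul]

lemma afL_imaginaryPart_le (h : IsTracialAF 𝒜 τ) (a : A) :
    afL 𝒜 τ β (ℑ a : A) ≤ afL 𝒜 τ β a := by
  have e : ℑ a = ℜ (-Complex.I • a) := by rw [neg_smul, map_neg, realPart_I_smul, neg_neg]
  rw [e]
  refine (afL_realPart_le h _).trans_eq ?_
  rw [afL_smul, enorm_neg, ← ofReal_norm, Complex.norm_I, ENNReal.ofReal_one, one_mul]

variable (hβ : ∀ n, 0 < β n)
include hβ

omit [StarOrderedRing A] in
lemma afL_le_iff {a : A} {r : ℝ≥0} :
    afL 𝒜 τ β a ≤ r ↔ ∀ n, ‖a - condExp τ (𝒜 n) a‖ ≤ r * β n := by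
  simp only [afL, iSup_le_iff, enorm_div_ofReal_le_iff (hβ _)]

variable (h : IsTracialAF 𝒜 τ)
include h

lemma afL_ne_top_of_mem {N : ℕ} {a : A} (ha : a ∈ 𝒜 N) : afL 𝒜 τ β a ≠ ∞ := by
  obtain ⟨r, hr⟩ := exists_le_mul_of_eventually_zero (f := fun n => ‖a - condExp τ (𝒜 n) a‖)
    (fun _ => norm_nonneg _) hβ (N := N) fun n hn => by
      simp [h.condExp_of_mem (h.mono hn ha)]
  exact ne_top_of_le_ne_top (ENNReal.coe_ne_top (r := r)) ((afL_le_iff hβ).2 hr)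

lemma afL_mul_le {a b : A} {r s : ℝ≥0} (ha : afL 𝒜 τ β a ≤ r) (hb : afL 𝒜 τ β b ≤ s) :
    afL 𝒜 τ β (a * b) ≤ ↑(2 * (‖a‖₊ * s + ‖b‖₊ * r)) := by
  rw [afL_le_iff hβ] at ha hb ⊢
  intro n
  refine (h.norm_mul_sub_condExp_le n a b).trans ?_
  push_cast
  have h1 := mul_le_mul_of_nonneg_left (hb n) (norm_nonneg a)
  have h2 := mul_le_mul_of_nonneg_left (ha n) (norm_nonneg b)
  linarith

end Lip

section Metric

variable {β : ℕ → ℝ} (hβ : ∀ n, 0 < β n) (h : IsTracialAF 𝒜 τ)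

omit [PartialOrder A] [StarOrderedRing A] in
lemma _root_.ModularPropinquity.enorm_sub_apply_le_mkDist {L : selfAdjoint A → ℝ≥0∞}
    {φ ψ : State A} {a : selfAdjoint A} (ha : L a ≤ 1) :
    ‖φ.1 (a : A) - ψ.1 (a : A)‖ₑ ≤ mkDist L φ ψ :=
  le_iSup₂ (f := fun (a : selfAdjoint A) (_ : L a ≤ 1) => ‖φ.1 (a : A) - ψ.1 (a : A)‖ₑ) a ha

lemma _root_.ModularPropinquity.State.norm_sub_apply_le (φ ψ : State A) (a : A) :
    ‖φ.1 a - ψ.1 a‖ ≤ 4 * ‖a‖ := by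
  linarith [norm_sub_le (φ.1 a) (ψ.1 a), φ.norm_apply_le a, ψ.norm_apply_le a]

include h

/-- `E_0` takes scalar values, which the difference of two states does not see. -/
lemma sub_condExp_zero_apply (φ ψ : State A) (a : A) :
    φ.1 (a - condExp τ (𝒜 0) a) - ψ.1 (a - condExp τ (𝒜 0) a) = φ.1 a - ψ.1 a := by
  rw [h.condExp_zero, map_sub, map_sub, map_smul, map_smul, φ.2.2, ψ.2.2]
  ring

include hβ

lemma mkDist_ne_top (φ ψ : State A) :
    mkDist (fun a : selfAdjoint A => afL 𝒜 τ β (a : A)) φ ψ ≠ ∞ := by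
  refine ne_top_of_le_ne_top (ENNReal.ofReal_ne_top (r := 4 * β 0)) (iSup₂_le fun a ha => ?_)
  have ha' := (afL_le_iff hβ (r := 1)).1 ha 0
  rw [← h.sub_condExp_zero_apply, ← ofReal_norm]
  refine ENNReal.ofReal_le_ofReal ((State.norm_sub_apply_le φ ψ _).trans ?_)
  simpa using ha'

/-- Weak-⋆ convergence implies convergence for `mk_L`: modulo scalars, the unit ball of `L_β` is
approximated by a ball of some `A_N`, which has a finite net. -/
lemma tendsto_mkDist_nhds (hβ0 : Filter.Tendsto β Filter.atTop (𝓝 0)) (φ : State A) :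
    Filter.Tendsto (fun ψ => mkDist (fun a : selfAdjoint A => afL 𝒜 τ β (a : A)) ψ φ)
      (𝓝 φ) (𝓝 0) := by
  rw [ENNReal.tendsto_nhds_zero]
  intro ε hε
  obtain ⟨δ, hδ0, hδ⟩ := ENNReal.lt_iff_exists_nnreal_btwn.1 hε
  have hδ0' : (0 : ℝ) < δ := by exact_mod_cast hδ0
  obtain ⟨N, hN⟩ := (hβ0.eventually_lt_const (show (0 : ℝ) < δ / 9 by positivity)).exists
  obtain ⟨t, htfin, ht⟩ := Metric.totallyBounded_iff.1 (h.isCompact_ball N (β 0)).totallyBounded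
    (δ / 9) (by positivity)
  have hev : ∀ᶠ ψ : State A in 𝓝 φ, ∀ y ∈ t, ‖ψ.1 y - φ.1 y‖ < δ / 9 := by
    rw [Filter.eventually_all_finite htfin]
    intro y _
    have hc : Continuous fun ψ : State A => ψ.1 y :=
      (continuous_apply y).comp continuous_induced_dom
    simpa [dist_eq_norm] using
      (Metric.tendsto_nhds.1 (hc.tendsto φ)) (δ / 9) (by positivity)
  filter_upwards [hev] with ψ hψ
  refine le_trans (iSup₂_le fun a ha => ?_) hδ.le
  have ha' := (afL_le_iff hβ (r := 1)).1 ha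
  simp only [NNReal.coe_one, one_mul] at ha'
  set a₀ : A := a - condExp τ (𝒜 0) (a : A) with ha₀
  set x := condExp τ (𝒜 N) a₀ with hx
  have hxb : ‖x‖ ≤ β 0 := (h.norm_condExp_le N a₀).trans (ha' 0)
  have hxa : a₀ - x = a - condExp τ (𝒜 N) (a : A) := by
    rw [hx, ha₀, map_sub,
      h.condExp_of_mem (h.mono (Nat.zero_le N) (h.condExp_mem 0 (a : A)))]
    abel
  obtain ⟨y, hy, hxy⟩ := Set.mem_iUnion₂.1 (ht ⟨h.condExp_mem N a₀, hxb⟩)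
  rw [Metric.mem_ball, dist_eq_norm] at hxy
  have e : ψ.1 (a : A) - φ.1 (a : A) = (ψ.1 (a₀ - x) - φ.1 (a₀ - x)) +
      (ψ.1 (x - y) - φ.1 (x - y)) + (ψ.1 y - φ.1 y) := by
    rw [← h.sub_condExp_zero_apply, ← ha₀]
    simp only [map_sub]; ring
  have h1 := State.norm_sub_apply_le ψ φ (a₀ - x)
  have h2 := State.norm_sub_apply_le ψ φ (x - y)
  have h3 := ha' N
  rw [← hxa] at h3
  have h4 := hψ y hy
  rw [e, ← ofReal_norm, ← ENNReal.ofReal_coe_nnreal]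
  refine ENNReal.ofReal_le_ofReal (norm_add₃_le.trans ?_)
  linarith

/-- Convergence for `mk_L` implies weak-⋆ convergence: it gives convergence on the domain of `L_β`,
which contains the dense subspace `⋃ A_n`. -/
lemma tendsto_apply_of_tendsto_mkDist (φ : State A) (l : Filter (State A))
    (hl : Filter.Tendsto (fun ψ => mkDist (fun a : selfAdjoint A => afL 𝒜 τ β (a : A)) ψ φ)
      l (𝓝 0)) (a : A) : Filter.Tendsto (fun ψ : State A => ψ.1 a) l (𝓝 (φ.1 a)) := by
  have hsa : ∀ a : selfAdjoint A, afL 𝒜 τ β (a : A) ≠ ∞ →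
      Filter.Tendsto (fun ψ : State A => ψ.1 (a : A)) l (𝓝 (φ.1 (a : A))) := fun a ha => by
    lift afL 𝒜 τ β (a : A) to ℝ≥0 using ha with r hr
    have hs : (0 : ℝ) < r + 1 := by positivity
    -- dividing by `r + 1` instead of `r` covers the case `L_β a = 0`
    have hb : afL 𝒜 τ β ((((r : ℝ) + 1)⁻¹ • a : selfAdjoint A) : A) ≤ 1 := by
      refine (afL_le_iff hβ (r := 1)).2 fun n => ?_
      have := (afL_le_iff hβ).1 hr.ge n
      rw [selfAdjoint.val_smul, ← Complex.coe_smul, map_smul, ← smul_sub, norm_smul,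
        Complex.norm_real, Real.norm_of_nonneg (by positivity), inv_mul_le_iff₀ hs]
      have := (hβ n).le
      push_cast
      linarith
    rw [tendsto_iff_edist_tendsto_0]
    have h0 : Filter.Tendsto (fun ψ => ENNReal.ofReal (r + 1) *
        mkDist (fun a : selfAdjoint A => afL 𝒜 τ β (a : A)) ψ φ) l (𝓝 0) := by
      simpa using ENNReal.Tendsto.const_mul hl (Or.inr ENNReal.ofReal_ne_top)
    refine tendsto_of_tendsto_of_tendsto_of_le_of_le tendsto_const_nhds h0
      (fun _ => zero_le) fun ψ => ?_
    have := enorm_sub_apply_le_mkDist (L := fun a : selfAdjoint A => afL 𝒜 τ β (a : A))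
      (φ := ψ) (ψ := φ) hb
    change edist (ψ.1 (a : A)) (φ.1 (a : A)) ≤ _
    rw [edist_eq_enorm_sub]
    refine le_trans (le_of_eq ?_) (mul_le_mul_right this _)
    rw [selfAdjoint.val_smul, ← Complex.coe_smul, map_smul, map_smul, ← smul_sub, enorm_smul,
      ← mul_assoc, ← ofReal_norm (Complex.ofReal _), Complex.norm_real,
      Real.norm_of_nonneg (by positivity), ← ENNReal.ofReal_mul hs.le, mul_inv_cancel₀ hs.ne',
      ENNReal.ofReal_one, one_mul]
  have hmem : ∀ N, ∀ b ∈ 𝒜 N,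
      Filter.Tendsto (fun ψ : State A => ψ.1 b) l (𝓝 (φ.1 b)) := fun N b hb => by
    have hL := afL_ne_top_of_mem hβ h hb
    have h1 := hsa (ℜ b) (ne_top_of_le_ne_top hL (afL_realPart_le h b))
    have h2 := hsa (ℑ b) (ne_top_of_le_ne_top hL (afL_imaginaryPart_le h b))
    have h3 := h1.add (h2.const_smul Complex.I)
    simpa only [← map_smul, ← map_add, realPart_add_I_smul_imaginaryPart] using h3
  rw [Metric.tendsto_nhds]
  intro ε hε
  obtain ⟨b, hb, hb'⟩ := Metric.dense_iff.1 h.dense a (ε / 8) (by positivity)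
  obtain ⟨N, hN⟩ := Set.mem_iUnion.1 hb'
  rw [Metric.mem_ball, dist_comm, dist_eq_norm] at hb
  filter_upwards [Metric.tendsto_nhds.1 (hmem N b hN) (ε / 2) (by positivity)] with ψ hψ
  rw [dist_eq_norm] at hψ ⊢
  have e : ψ.1 a - φ.1 a = (ψ.1 (a - b) - φ.1 (a - b)) + (ψ.1 b - φ.1 b) := by
    simp only [map_sub]; ring
  rw [e]
  linarith [norm_add_le (ψ.1 (a - b) - φ.1 (a - b)) (ψ.1 b - φ.1 b),
    State.norm_sub_apply_le ψ φ (a - b)]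

lemma nhds_eq_comap_mkDist (hβ0 : Filter.Tendsto β Filter.atTop (𝓝 0)) (φ : State A) :
    𝓝 φ = Filter.comap
      (fun ψ => mkDist (fun a : selfAdjoint A => afL 𝒜 τ β (a : A)) ψ φ) (𝓝 0) := by
  refine le_antisymm (h.tendsto_mkDist_nhds hβ hβ0 φ).le_comap ?_
  rw [nhds_induced, ← Filter.tendsto_iff_comap, tendsto_pi_nhds]
  exact fun a => h.tendsto_apply_of_tendsto_mkDist hβ φ _ Filter.tendsto_comap a

lemma isQuantumCompactMetricSpace (hβ0 : Filter.Tendsto β Filter.atTop (𝓝 0)) :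
    IsQuantumCompactMetricSpace afF A fun a => afL 𝒜 τ β (a : A) where
  nontrivial := τ.nontrivial
  add_le a b := afL_add_le _ _
  smul t a := by
    have := afL_smul (𝒜 := 𝒜) (τ := τ) (β := β) (t : ℂ) (a : A)
    rw [Complex.coe_smul] at this
    rw [selfAdjoint.val_smul, this]
    congr 1
    rw [← ofReal_norm, ← ofReal_norm, Complex.norm_real]
  dense_dom := by
    have hc : Continuous fun a : A => ℜ a := by
      refine continuous_induced_rng.2 ?_
      simp only [Function.comp_def, realPart_apply_coe]
      fun_prop
    refine ((realPart_surjective.denseRange).dense_image hc h.dense).mono ?_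
    rintro _ ⟨b, hb, rfl⟩
    obtain ⟨N, hN⟩ := Set.mem_iUnion.1 hb
    exact ne_top_of_le_ne_top (afL_ne_top_of_mem hβ h hN) (afL_realPart_le h b)
  eq_zero_iff a := by
    constructor
    · intro ha
      have h1 := (afL_le_iff hβ (r := 0)).1 ha.le 0
      simp only [NNReal.coe_zero, zero_mul, norm_le_zero_iff, sub_eq_zero] at h1
      rw [h.condExp_zero] at h1
      refine ⟨(τ.1 (a : A)).re, Subtype.ext ?_⟩
      have h2 : (τ.1 (a : A)).im = 0 := by
        have := τ.map_star (a : A)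
        rw [a.2.star_eq] at this
        exact Complex.conj_eq_iff_im.1 this.symm
      rw [selfAdjoint.val_smul, ← Complex.coe_smul]
      conv_lhs => rw [h1]
      congr 1
      exact Complex.ext rfl h2
    · rintro ⟨t, rfl⟩
      refine le_antisymm ((afL_le_iff hβ (r := 0)).2 fun n => ?_) zero_le
      rw [h.condExp_of_mem]
      · simp
      · rw [selfAdjoint.val_smul, ← Complex.coe_smul]
        exact SMulMemClass.smul_mem _ (one_mem _)
  mk_ne_top := h.mkDist_ne_top hβ
  mk_metrizes φ := by
    rw [h.nhds_eq_comap_mkDist hβ hβ0 φ]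
    exact ENNReal.nhds_zero_basis.comap _
  lowerSemicontinuous := by
    have : {a : selfAdjoint A | afL 𝒜 τ β (a : A) ≤ 1} =
        ⋂ n, {a : selfAdjoint A | ‖(a : A) - condExp τ (𝒜 n) (a : A)‖ ≤ β n} := by
      ext a
      simpa using afL_le_iff hβ (r := 1) (𝒜 := 𝒜) (τ := τ) (a := (a : A))
    rw [this]
    refine isClosed_iInter fun n => isClosed_le ?_ continuous_const
    have := h.continuous_condExp n
    fun_prop
  leibniz a b ha hb := by
    have hab := afL_mul_le hβ h (ENNReal.coe_toNNReal ha).ge (ENNReal.coe_toNNReal hb).ge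
    exact max_le ((afL_realPart_le h _).trans hab) ((afL_imaginaryPart_le h _).trans hab)

end Metric
end IsTracialAF
end ModularPropinquity

/-! ### The metrized bundle of an ideal -/

namespace ModularPropinquity
namespace IsTracialAF

variable {A : Type u} [CStarAlgebra A] [PartialOrder A] [StarOrderedRing A]
  {𝒜 : ℕ → StarSubalgebra ℂ A} {τ : State A}

section ModuleNorm

variable {β : ℕ → ℝ} {I : ClosedIdeal A}

omit [StarOrderedRing A] in
lemma afD_add_le (a b : A) : afD 𝒜 τ β I (a + b) ≤ afD 𝒜 τ β I a + afD 𝒜 τ β I b := by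
  refine max_le (max_le ((afL_add_le a b).trans (add_le_add ?_ ?_))
    ((enorm_add_le a b).trans (add_le_add ?_ ?_))) ?_
  · exact (le_max_left _ _).trans (le_max_left _ _)
  · exact (le_max_left _ _).trans (le_max_left _ _)
  · exact (le_max_right _ _).trans (le_max_left _ _)
  · exact (le_max_right _ _).trans (le_max_left _ _)
  · have := iSup_enorm_div_add_le
      (fun n => LinearMap.id - LinearMap.mulRight ℂ (unitAt 𝒜 I n))
      (fun n => ENNReal.ofReal (β n)) a b
    simp only [LinearMap.sub_apply, LinearMap.id_apply, LinearMap.mulRight_apply] at this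
    exact this.trans (add_le_add (le_max_right _ _) (le_max_right _ _))

omit [StarOrderedRing A] in
lemma afD_smul (t : ℂ) (a : A) : afD 𝒜 τ β I (t • a) = ‖t‖ₑ * afD 𝒜 τ β I a := by
  have := iSup_enorm_div_smul
    (fun n => LinearMap.id - LinearMap.mulRight ℂ (unitAt 𝒜 I n))
    (fun n => ENNReal.ofReal (β n)) t a
  simp only [LinearMap.sub_apply, LinearMap.id_apply, LinearMap.mulRight_apply] at this
  rw [afD, afD, this, afL_smul, enorm_smul, mul_max, mul_max]

omit [StarOrderedRing A] in
lemma enorm_le_afD (a : A) : ‖a‖ₑ ≤ afD 𝒜 τ β I a :=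
  (le_max_right _ _).trans (le_max_left _ _)

omit [StarOrderedRing A] in
lemma afL_le_afD (a : A) : afL 𝒜 τ β a ≤ afD 𝒜 τ β I a :=
  (le_max_left _ _).trans (le_max_left _ _)

variable (hβ : ∀ n, 0 < β n)
include hβ

omit [StarOrderedRing A] in
lemma afD_le_iff {a : A} {r : ℝ≥0} :
    afD 𝒜 τ β I a ≤ r ↔ (∀ n, ‖a - condExp τ (𝒜 n) a‖ ≤ r * β n) ∧ ‖a‖ ≤ r ∧
      ∀ n, ‖a - a * unitAt 𝒜 I n‖ ≤ r * β n := by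
  rw [afD, max_le_iff, max_le_iff, afL_le_iff hβ, and_assoc, iSup_le_iff]
  refine and_congr_right fun _ => and_congr ?_ (forall_congr' fun n => ?_)
  · rw [enorm_le_coe]; rfl
  · exact enorm_div_ofReal_le_iff (hβ n)

variable (h : IsTracialAF 𝒜 τ)
include h

lemma afD_ne_top_of_mem {N : ℕ} {a : A} (ha : a ∈ 𝒜 N) (haI : a ∈ I.toIdeal) :
    afD 𝒜 τ β I a ≠ ∞ := by
  obtain ⟨r, hr⟩ := exists_le_mul_of_eventually_zero (f := fun n => ‖a - a * unitAt 𝒜 I n‖)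
    (fun _ => norm_nonneg _) hβ (N := N) fun n hn => by
      simp [h.mul_unitAt I haI (h.mono hn ha)]
  refine (max_lt (max_lt (afL_ne_top_of_mem hβ h ha).lt_top enorm_lt_top) ?_).ne
  refine lt_of_le_of_lt (iSup_le fun n => ?_) (ENNReal.coe_lt_top (r := r))
  exact (enorm_div_ofReal_le_iff (hβ n)).2 (hr n)

lemma afD_mul_le {a b : A} {r s : ℝ≥0} (ha : afL 𝒜 τ β a ≤ r) (hb : afD 𝒜 τ β I b ≤ s) :
    afD 𝒜 τ β I (a * b) ≤ ↑(afG ‖a‖₊ r s) := by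
  have hbL := (afL_le_afD b).trans hb
  obtain ⟨-, hb2, hb3⟩ := (afD_le_iff hβ).1 hb
  have h1 := (afL_le_iff hβ).1 (afL_mul_le hβ h ha hbL)
  have hs : (0 : ℝ) ≤ s := s.2
  have hr : (0 : ℝ) ≤ r := r.2
  have e : ((afG ‖a‖₊ r s : ℝ≥0) : ℝ) = 2 * (‖a‖ * s + r * s) := by
    simp [afG, afF]
  have hpos : 0 ≤ ‖a‖ * (s : ℝ) := by positivity
  have hpos' : 0 ≤ (r : ℝ) * s := by positivity
  refine (afD_le_iff hβ).2 ⟨fun n => (h1 n).trans ?_, ?_, fun n => ?_⟩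
  · rw [e]
    refine mul_le_mul_of_nonneg_right ?_ (hβ n).le
    push_cast
    have : ‖b‖ * (r : ℝ) ≤ r * s := by rw [mul_comm]; exact mul_le_mul_of_nonneg_left hb2 hr
    linarith
  · rw [e]
    refine (norm_mul_le _ _).trans ((mul_le_mul_of_nonneg_left hb2 (norm_nonneg a)).trans ?_)
    linarith
  · rw [e, mul_assoc a b, ← mul_sub]
    refine (norm_mul_le _ _).trans ((mul_le_mul_of_nonneg_left (hb3 n) (norm_nonneg a)).trans ?_)
    rw [← mul_assoc]
    exact mul_le_mul_of_nonneg_right (by linarith) (hβ n).le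

/-- The unit ball of `D_I` is within `β N` of the unit ball of `A_N`. -/
lemma isCompact_afD_ball (hβ0 : Filter.Tendsto β Filter.atTop (𝓝 0)) :
    IsCompact {a : A | a ∈ I.toIdeal ∧ afD 𝒜 τ β I a ≤ 1} := by
  refine TotallyBounded.isCompact_of_isClosed ?_ ?_
  · rw [Metric.totallyBounded_iff]
    intro ε hε
    obtain ⟨N, hN⟩ := (hβ0.eventually_lt_const (half_pos hε)).exists
    obtain ⟨t, htfin, ht⟩ := Metric.totallyBounded_iff.1 (h.isCompact_ball N 1).totallyBounded
      (ε / 2) (half_pos hε)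
    refine ⟨t, htfin, fun a ha => ?_⟩
    obtain ⟨h1, h2, -⟩ := (afD_le_iff hβ (r := 1)).1 ha.2
    obtain ⟨y, hy, hxy⟩ := Set.mem_iUnion₂.1
      (ht ⟨h.condExp_mem N a, (h.norm_condExp_le N a).trans h2⟩)
    refine Set.mem_iUnion₂.2 ⟨y, hy, ?_⟩
    rw [Metric.mem_ball] at hxy ⊢
    have h3 := h1 N
    rw [← dist_eq_norm, NNReal.coe_one, one_mul] at h3
    linarith [dist_triangle a (condExp τ (𝒜 N) a) y]
  · have : {a : A | a ∈ I.toIdeal ∧ afD 𝒜 τ β I a ≤ 1} = (I.toIdeal : Set A) ∩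
        ((⋂ n, {a | ‖a - condExp τ (𝒜 n) a‖ ≤ β n}) ∩
          ({a | ‖a‖ ≤ 1} ∩ ⋂ n, {a | ‖a - a * unitAt 𝒜 I n‖ ≤ β n})) := by
      ext a
      simpa using fun _ => afD_le_iff hβ (r := 1) (𝒜 := 𝒜) (τ := τ) (a := a) (I := I)
    rw [this]
    refine I.isClosed.inter (IsClosed.inter (isClosed_iInter fun n => ?_)
      (IsClosed.inter ?_ (isClosed_iInter fun n => ?_)))
    · have := h.continuous_condExp n
      exact isClosed_le (by fun_prop) continuous_const
    · exact isClosed_le continuous_norm continuous_const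
    · exact isClosed_le (by fun_prop) continuous_const

variable (I) in
lemma isMetrizedBundle (hβ0 : Filter.Tendsto β Filter.atTop (𝓝 0)) :
    IsMetrizedBundle afF afG afH (afBundle 𝒜 τ β I) where
  admissible := by
    refine ⟨⟨fun x₁ x₂ x₃ x₄ y₁ y₂ y₃ y₄ h1 h2 h3 h4 => ?_, fun x₁ x₂ x₃ x₄ => ?_⟩,
      ⟨fun x y z x' y' z' h1 h2 h3 => ?_, fun x y z => ?_⟩,
      ⟨fun x y x' y' h1 h2 => ?_, fun x y => ?_⟩⟩
    · unfold afF; gcongr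
    · unfold afF; exact le_mul_of_one_le_left zero_le one_le_two
    · unfold afG afF; gcongr
    · unfold afG afF; rw [add_mul]; exact le_mul_of_one_le_left zero_le one_le_two
    · unfold afH afF; gcongr
    · unfold afH afF
      rw [mul_assoc]; gcongr; exact le_self_add
  base := isQuantumCompactMetricSpace (A := A) hβ h hβ0
  add_le ω η := afD_add_le (A := A) (ω : I.toIdeal).1 (η : I.toIdeal).1
  smul c ω := afD_smul (A := A) c (ω : I.toIdeal).1
  dense_dom := by
    refine Metric.dense_iff.2 fun (ω : I.toIdeal) ε hε => ?_
    obtain ⟨n, b, hb, hbI, hab⟩ := h.exists_mem_ideal_norm_sub_lt I ω.2 hε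
    refine ⟨(⟨b, hbI⟩ : I.toIdeal), ?_, afD_ne_top_of_mem hβ h hb hbI⟩
    change dist b (ω : A) < ε
    rwa [dist_comm, dist_eq_norm]
  norm_le ω := enorm_le_afD (A := A) (ω : I.toIdeal).1
  compact := by
    have := (I.isClosed.isClosedEmbedding_subtypeVal).isCompact_preimage
      (isCompact_afD_ball (I := I) hβ h hβ0)
    have e : {ω : I.toIdeal | afD 𝒜 τ β I (ω : A) ≤ 1} =
        Subtype.val ⁻¹' {a : A | a ∈ I.toIdeal ∧ afD 𝒜 τ β I a ≤ 1} :=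
      Set.ext fun ω => ⟨fun hω => ⟨ω.2, hω⟩, fun hω => hω.2⟩
    change IsCompact {ω : I.toIdeal | afD 𝒜 τ β I (ω : A) ≤ 1}
    rw [e]
    exact this
  module_leibniz (a : selfAdjoint A) (ω : I.toIdeal) ha hω :=
    afD_mul_le (A := A) hβ h (ENNReal.coe_toNNReal ha).ge (ENNReal.coe_toNNReal hω).ge
  inner_leibniz := by
    intro (ω : I.toIdeal) (η : I.toIdeal) hω hη
    change afD 𝒜 τ β I (ω : A) ≠ ∞ at hω
    change afD 𝒜 τ β I (η : A) ≠ ∞ at hη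
    have key : afL 𝒜 τ β ((ω : A) * star (η : A)) ≤
        afH (afD 𝒜 τ β I (ω : A)).toNNReal (afD 𝒜 τ β I (η : A)).toNNReal := by
      have h1 := (ENNReal.coe_toNNReal hω).ge
      have h2 := (ENNReal.coe_toNNReal hη).ge
      have h3 := ((afL_le_afD (ω : A)).trans h1)
      have h4 := ((afL_star h (η : A)).le.trans (afL_le_afD (η : A))).trans h2
      have h5 := ((afD_le_iff hβ).1 h1).2.1
      have h6 := ((afD_le_iff hβ).1 h2).2.1
      refine (afL_mul_le hβ h h3 h4).trans (ENNReal.coe_le_coe.2 ?_)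
      rw [afH, afF, nnnorm_star]
      gcongr 2 * (?_ + ?_)
      · exact mul_le_mul_of_nonneg_right h5 (NNReal.coe_nonneg _)
      · rw [mul_comm]; exact mul_le_mul_of_nonneg_left h6 (NNReal.coe_nonneg _)
    exact max_le ((afL_realPart_le h _).trans key) ((afL_imaginaryPart_le h _).trans key)

end ModuleNorm

end IsTracialAF
end ModularPropinquity

/-! ### Bridges between the bundles of two ideals -/

namespace ModularPropinquity
namespace IsTracialAF

/-- A sequence whose successive ratios tend to `0` is eventually small relative to all of its
earlier terms. -/
lemma exists_le_mul_of_ratio {β : ℕ → ℝ} (hβ : ∀ n, 0 < β n)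
    (hβ0 : Filter.Tendsto β Filter.atTop (𝓝 0))
    (hβr : Filter.Tendsto (fun n => β (n + 1) / β n) Filter.atTop (𝓝 0)) {ε : ℝ} (hε : 0 < ε) :
    ∃ N, β N < ε ∧ ∀ n < N, β N ≤ ε * β n := by
  obtain ⟨N₀, hN₀⟩ := Filter.eventually_atTop.1
    (hβr.eventually_lt_const (show 0 < min ε 1 from lt_min hε one_pos))
  -- beyond `N₀` the sequence decreases, and each term is at most `ε` times the one before it
  have hstep : ∀ n, N₀ ≤ n → β (n + 1) ≤ min ε 1 * β n := fun n hn =>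
    ((div_lt_iff₀ (hβ n)).1 (hN₀ n hn)).le
  have hanti : ∀ m n, N₀ ≤ m → m ≤ n → β n ≤ β m := fun m n hm hmn => by
    induction n, hmn using Nat.le_induction with
    | base => rfl
    | succ k hk ih =>
      refine (hstep k (hm.trans hk)).trans (le_trans ?_ ih)
      exact mul_le_of_le_one_left (hβ k).le (min_le_right _ _)
  have hfin : ∀ᶠ N in Filter.atTop, ∀ n ∈ Set.Iio N₀, β N < ε * β n := by
    rw [Filter.eventually_all_finite (Set.finite_Iio N₀)]
    exact fun n _ => hβ0.eventually_lt_const (mul_pos hε (hβ n))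
  obtain ⟨N, h1, h2, h3⟩ := (hfin.and ((hβ0.eventually_lt_const hε).and
    (Filter.eventually_gt_atTop N₀))).exists
  refine ⟨N, h2, fun n hn => ?_⟩
  rcases lt_or_ge n N₀ with hn0 | hn0
  · exact (h1 n hn0).le
  · obtain ⟨M, rfl⟩ := Nat.exists_eq_add_of_lt hn
    calc β (n + M + 1) ≤ min ε 1 * β (n + M) := hstep _ (by omega)
      _ ≤ ε * β n := mul_le_mul (min_le_left _ _) (hanti n _ hn0 (by omega)) (hβ _).le hε.le

variable {A : Type u} [CStarAlgebra A] [PartialOrder A] [StarOrderedRing A]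
  {𝒜 : ℕ → StarSubalgebra ℂ A} {τ : State A} {β : ℕ → ℝ}

section Approximation

variable (hβ : ∀ n, 0 < β n) (h : IsTracialAF 𝒜 τ)
include hβ h

/-- An element `ω` of the unit ball of `D_I` is close to an element of that ball in `I ∩ A_N`,
namely to `E_N (ω 1_N)`, scaled by the factor `1 + 2 ε` by which its `D_I` may exceed `1`. -/
lemma exists_norm_sub_le_of_afD_le {I : ClosedIdeal A} {N : ℕ} {ε : ℝ} (hε : 0 < ε)
    (hN : β N < ε) (hN' : ∀ n < N, β N ≤ ε * β n) {ω : A}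
    (hω : afD 𝒜 τ β I ω ≤ 1) :
    ∃ η ∈ 𝒜 N, η ∈ I.toIdeal ∧ afD 𝒜 τ β I η ≤ 1 ∧ ‖η - ω‖ ≤ 4 * ε := by
  obtain ⟨h1, h2, h3⟩ := (afD_le_iff hβ (r := 1)).1 hω
  simp only [NNReal.coe_one, one_mul] at h1 h2 h3
  set e := unitAt 𝒜 I N with he
  have heA : e ∈ 𝒜 N := h.unitAt_mem I N
  set x := ω * e with hx
  set η := condExp τ (𝒜 N) x with hη
  have hηA : η ∈ 𝒜 N := h.condExp_mem N x
  have hηe : η = condExp τ (𝒜 N) ω * e := h.condExp_mul_right heA ω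
  have hηI : η ∈ I.toIdeal := by
    rw [hηe]; exact I.toIdeal.mul_mem_left _ (h.unitAt_mem_ideal I N)
  have hη1 : ‖η‖ ≤ 1 :=
    (h.norm_condExp_le N x).trans ((h.norm_mul_unitAt_le I N ω).trans h2)
  have hηω : ‖η - ω‖ ≤ 2 * β N := by
    have e1 : η - ω = -((ω - condExp τ (𝒜 N) ω) * e) - (ω - ω * e) := by
      rw [hηe]; noncomm_ring
    rw [e1]
    have h4 := (h.norm_mul_unitAt_le I N (ω - condExp τ (𝒜 N) ω)).trans (h1 N)
    have h5 := norm_sub_le (-((ω - condExp τ (𝒜 N) ω) * e)) (ω - ω * e)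
    rw [norm_neg] at h5
    have h6 := h3 N
    linarith
  let s : ℝ≥0 := ⟨1 + 2 * ε, by positivity⟩
  have hs : (s : ℝ) = 1 + 2 * ε := rfl
  -- only the indices `n < N` matter, and for those `β N ≤ ε * β n`
  have hDη : afD 𝒜 τ β I η ≤ s := by
    refine (afD_le_iff hβ).2 ⟨fun n => ?_, ?_, fun n => ?_⟩
    · rcases lt_or_ge n N with hn | hn
      · have e1 : η - condExp τ (𝒜 n) η = condExp τ (𝒜 N) (x - condExp τ (𝒜 n) x) := by
          rw [map_sub, h.condExp_of_mem (h.mono hn.le (h.condExp_mem n x)), hη,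
            h.condExp_condExp hn.le]
        have e2 : x - condExp τ (𝒜 n) x = (ω - condExp τ (𝒜 n) ω) -
            (ω - x) + condExp τ (𝒜 n) (ω - x) := by
          rw [map_sub]; abel
        rw [e1]
        refine (h.norm_condExp_le N _).trans ?_
        rw [e2, hs]
        have h4 := h.norm_condExp_le n (ω - x)
        have h5 := norm_add_le ((ω - condExp τ (𝒜 n) ω) - (ω - x)) (condExp τ (𝒜 n) (ω - x))
        have h6 := norm_sub_le (ω - condExp τ (𝒜 n) ω) (ω - x)
        have h7 := h1 n
        have h8 := h3 N
        have h9 := hN' n hn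
        linarith
      · rw [h.condExp_of_mem (h.mono hn hηA), sub_self, norm_zero]
        exact mul_nonneg s.coe_nonneg (hβ n).le
    · rw [hs]; linarith
    · rcases lt_or_ge n N with hn | hn
      · set f := unitAt 𝒜 I n
        have hfA : f ∈ 𝒜 N := h.mono hn.le (h.unitAt_mem I n)
        have e1 : η - η * f = condExp τ (𝒜 N) ((ω - ω * f) * e) := by
          have e2 : (ω - ω * f) * e = x - x * f := by
            rw [hx, sub_mul, mul_assoc ω f e, mul_assoc ω e f, h.unitAt_comm I hfA]
          rw [e2, map_sub, h.condExp_mul_right hfA]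
        rw [e1, hs]
        refine (h.norm_condExp_le N _).trans ((h.norm_mul_unitAt_le I N _).trans ?_)
        have h7 := h3 n
        have h8 := mul_pos hε (hβ n)
        linarith
      · rw [h.mul_unitAt I hηI (h.mono hn hηA), sub_self, norm_zero]
        exact mul_nonneg s.coe_nonneg (hβ n).le
  have hs0 : (0 : ℝ) < s := by rw [hs]; positivity
  have hcn : ‖((s⁻¹ : ℝ) : ℂ)‖ = (s : ℝ)⁻¹ := by
    rw [Complex.norm_real, Real.norm_of_nonneg (by positivity)]
  refine ⟨((s⁻¹ : ℝ) : ℂ) • η, SMulMemClass.smul_mem _ hηA,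
    (I.toIdeal.restrictScalars ℂ).smul_mem _ hηI, ?_, ?_⟩
  · rw [afD_smul, ← ofReal_norm, hcn, ENNReal.ofReal_inv_of_pos hs0, ENNReal.ofReal_coe_nnreal]
    refine (mul_le_mul_right hDη _).trans_eq ?_
    exact ENNReal.inv_mul_cancel (by exact_mod_cast hs0.ne') ENNReal.coe_ne_top
  · have e1 : ((s⁻¹ : ℝ) : ℂ) • η - ω = (((s : ℝ)⁻¹ - 1 : ℝ) : ℂ) • η + (η - ω) := by
      push_cast
      rw [sub_smul, one_smul]; abel
    have hinv : (s : ℝ)⁻¹ ≤ 1 := inv_le_one_of_one_le₀ (by rw [hs]; linarith)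
    have hinv' : 1 - (s : ℝ)⁻¹ ≤ 2 * ε := by
      have : 1 - (s : ℝ)⁻¹ = 2 * ε * (s : ℝ)⁻¹ := by field_simp; rw [hs]; ring
      rw [this]
      exact mul_le_of_le_one_right (by positivity) hinv
    rw [e1]
    refine (norm_add_le _ _).trans ?_
    rw [norm_smul, Complex.norm_real, Real.norm_eq_abs, abs_sub_comm, abs_of_nonneg (by linarith)]
    have := mul_le_mul hinv' hη1 (norm_nonneg η) (by positivity)
    linarith

end Approximation

section Bridge

lemma modularMK_le (I : ClosedIdeal A) (ω η : I.toIdeal) :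
    (afBundle 𝒜 τ β I).modularMK ω η ≤ ‖(ω : A) - (η : A)‖ₑ := by
  refine iSup₂_le fun (ξ : I.toIdeal) hξ => ?_
  have hξ1 : ‖(ξ : A)‖ₑ ≤ 1 := (enorm_le_afD (ξ : A)).trans hξ
  change ‖(ω : A) * star (ξ : A) - (η : A) * star (ξ : A)‖ₑ ≤ _
  rw [← sub_mul]
  have h1 : ‖(ξ : A)‖ ≤ 1 := by
    rw [← ofReal_norm, ← ENNReal.ofReal_one] at hξ1
    exact (ENNReal.ofReal_le_ofReal_iff zero_le_one).1 hξ1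
  rw [← ofReal_norm, ← ofReal_norm]
  refine ENNReal.ofReal_le_ofReal ((norm_mul_le _ _).trans ?_)
  rw [norm_star]
  exact mul_le_of_le_one_right (norm_nonneg _) h1

omit [PartialOrder A] [StarOrderedRing A] in
lemma unitAt_congr {I I' : ClosedIdeal A} {N n : ℕ} (hmono : Monotone 𝒜)
    (hI : ∀ x ∈ 𝒜 N, x ∈ I.toIdeal ↔ x ∈ I'.toIdeal) (hn : n ≤ N) :
    unitAt 𝒜 I n = unitAt 𝒜 I' n := by
  have : (I.toIdeal : Set A) ∩ 𝒜 n = (I'.toIdeal : Set A) ∩ 𝒜 n := by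
    ext x
    exact ⟨fun hx => ⟨(hI x (hmono hn hx.2)).1 hx.1, hx.2⟩,
      fun hx => ⟨(hI x (hmono hn hx.2)).2 hx.1, hx.2⟩⟩
  rw [unitAt, this]

variable (h : IsTracialAF 𝒜 τ)
include h

/-- For `n ≥ N` the units of `I ∩ A_n` and `I' ∩ A_n` both fix the elements of `I ∩ A_N`. -/
lemma afD_congr {I I' : ClosedIdeal A} {N : ℕ}
    (hI : ∀ x ∈ 𝒜 N, x ∈ I.toIdeal ↔ x ∈ I'.toIdeal) {ω : A} (hω : ω ∈ 𝒜 N)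
    (hωI : ω ∈ I.toIdeal) : afD 𝒜 τ β I ω = afD 𝒜 τ β I' ω := by
  rw [afD, afD]
  congr 1
  refine iSup_congr fun n => ?_
  rcases le_total n N with hn | hn
  · have : unitAt 𝒜 I n = unitAt 𝒜 I' n := unitAt_congr h.mono hI hn
    unfold unitAt at this
    rw [this]
  · have h1 : ω * unitAt 𝒜 I n = ω := h.mul_unitAt I hωI (h.mono hn hω)
    have h2 : ω * unitAt 𝒜 I' n = ω := h.mul_unitAt I' ((hI ω hω).1 hωI) (h.mono hn hω)
    unfold unitAt at h1 h2
    rw [h1, h2]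

/-- The bridge with pivot `1` between the modules of two ideals with the same intersection with
`A_N`; its anchors and coanchors are the elements of the unit ball of `D` in that intersection. -/
noncomputable def idealBridge {I I' : ClosedIdeal A} {N : ℕ}
    (hI : ∀ x ∈ 𝒜 N, x ∈ I.toIdeal ↔ x ∈ I'.toIdeal) :
    ModularBridge (afBundle 𝒜 τ β I) (afBundle 𝒜 τ β I') where
  D := A
  pivot := 1
  norm_pivot_le := by
    have := τ.nontrivial
    simp
  levelSet_nonempty := ⟨τ, by simp [levelSet]⟩
  π₁ := StarAlgHom.id ℂ A
  π₂ := StarAlgHom.id ℂ A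
  injective₁ := fun _ _ h => h
  injective₂ := fun _ _ h => h
  J := {ω : A // ω ∈ 𝒜 N ∧ ω ∈ I.toIdeal ∧ afD 𝒜 τ β I ω ≤ 1}
  nonempty := ⟨⟨0, zero_mem _, zero_mem _, by
    have := afD_smul (𝒜 := 𝒜) (τ := τ) (β := β) (I := I) 0 0
    simp only [smul_zero, enorm_zero, zero_mul] at this
    simp [this]⟩⟩
  anchor j := (⟨j.1, j.2.2.1⟩ : I.toIdeal)
  coanchor j := (⟨j.1, (hI _ j.2.1).1 j.2.2.1⟩ : I'.toIdeal)
  anchor_le j := j.2.2.2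
  coanchor_le j := (h.afD_congr hI j.2.1 j.2.2.1).ge.trans j.2.2.2

lemma haus_modularMK_le (hβ : ∀ n, 0 < β n) {I : ClosedIdeal A} {N : ℕ} {ε : ℝ} (hε : 0 < ε)
    (hN : β N < ε) (hN' : ∀ n < N, β N ≤ ε * β n) {J : Type u} (f : J → I.toIdeal)
    (hf : ∀ j, afD 𝒜 τ β I (f j : A) ≤ 1)
    (hf' : ∀ x ∈ 𝒜 N, x ∈ I.toIdeal → afD 𝒜 τ β I x ≤ 1 → ∃ j, (f j : A) = x) :
    haus (afBundle 𝒜 τ β I).modularMK (Set.range f) {ω | (afBundle 𝒜 τ β I).D ω ≤ 1} ≤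
      ENNReal.ofReal (4 * ε) := by
  refine max_le (iSup₂_le fun s hs => ?_) (iSup₂_le fun (ω : I.toIdeal) hω => ?_)
  · obtain ⟨j, rfl⟩ := hs
    refine (iInf₂_le (f j) (hf j)).trans ((modularMK_le I (f j) (f j)).trans ?_)
    simp
  · obtain ⟨η, hηA, hηI, hηD, hηω⟩ := h.exists_norm_sub_le_of_afD_le hβ hε hN hN' hω
    obtain ⟨j, hj⟩ := hf' η hηA hηI hηD
    refine (iInf₂_le (f j) ⟨j, rfl⟩).trans ((modularMK_le I (f j) ω).trans ?_)
    rw [hj, ← ofReal_norm]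
    exact ENNReal.ofReal_le_ofReal hηω

lemma length_idealBridge_le (hβ : ∀ n, 0 < β n) {I I' : ClosedIdeal A} {N : ℕ}
    (hI : ∀ x ∈ 𝒜 N, x ∈ I.toIdeal ↔ x ∈ I'.toIdeal) {ε : ℝ} (hε : 0 < ε)
    (hN : β N < ε) (hN' : ∀ n < N, β N ≤ ε * β n) :
    (h.idealBridge (β := β) hI).length ≤ ENNReal.ofReal (4 * ε) := by
  set γ := h.idealBridge (β := β) hI with hγ
  have hbn : ∀ a : A, γ.bn a a = 0 := fun a => by
    change ‖a * 1 - 1 * a‖ₑ = 0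
    simp
  have hmk : haus (mkDist fun a : selfAdjoint A => afL 𝒜 τ β (a : A)) Set.univ
      (State.pullback (StarAlgHom.id ℂ A) '' levelSet (1 : A)) = 0 := by
    have : State.pullback (StarAlgHom.id ℂ A) '' levelSet (1 : A) = Set.univ :=
      Set.eq_univ_of_forall fun φ => ⟨φ, by simp [levelSet], rfl⟩
    rw [this]
    exact haus_self_le _ (fun φ => by simp [mkDist]) _
  have hheight : γ.height = 0 := (max_eq_left le_rfl).trans hmk
  have hbasic : γ.basicReach = 0 := haus_self_le
    (fun a b : selfAdjoint A => γ.bn (a : A) (b : A)) (fun a => hbn a) _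
  have hmod : γ.modularReach = 0 := by
    refine le_antisymm (iSup_le fun j => iSup_le fun k => max_le ?_ ?_) zero_le
    · exact (hbn _).le
    · exact (hbn _).le
  have himp : γ.imprint ≤ ENNReal.ofReal (4 * ε) := by
    refine max_le ?_ ?_
    · exact h.haus_modularMK_le hβ hε hN hN' γ.anchor γ.anchor_le
        fun x hx hxI hxD => ⟨⟨x, hx, hxI, hxD⟩, rfl⟩
    · refine h.haus_modularMK_le hβ hε hN hN' γ.coanchor γ.coanchor_le fun x hx hxI hxD => ?_
      have hxI' := (hI x hx).2 hxI
      exact ⟨⟨x, hx, hxI', (h.afD_congr hI hx hxI').le.trans hxD⟩, rfl⟩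
  rw [ModularBridge.length, ModularBridge.reach, hheight, hbasic, hmod, zero_add]
  exact max_le zero_le (max_le zero_le himp)

end Bridge

end IsTracialAF
end ModularPropinquity

/-! ### Irreducible GNS representations -/

namespace ModularPropinquity

section Representations

variable {A : Type u} [CStarAlgebra A]

/-- The GNS representation of a state, with its cyclic vector. -/
lemma State.exists_cyclic_rep [PartialOrder A] [StarOrderedRing A] (φ : State A) :
    ∃ (H : Type u) (_ : NormedAddCommGroup H) (_ : InnerProductSpace ℂ H) (_ : CompleteSpace H)
      (π : A →⋆ₐ[ℂ] (H →L[ℂ] H)) (ξ : H),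
      (∀ a, inner ℂ ξ (π a ξ) = φ.1 a) ∧ DenseRange fun a => π a ξ := by
  let f := φ.toPositive
  let ξ : f.GNS := ((f.toPreGNS 1 : f.PreGNS) : f.GNS)
  have hξ : ∀ a, f.gnsStarAlgHom a ξ = ((f.toPreGNS a : f.PreGNS) : f.GNS) := fun a => by
    have := f.gnsNonUnitalStarAlgHom_apply_coe (a := a) (b := f.toPreGNS 1)
    rw [PositiveLinearMap.leftMulMapPreGNS_apply, PositiveLinearMap.ofPreGNS_toPreGNS,
      mul_one] at this
    exact this
  refine ⟨f.GNS, inferInstance, inferInstance, inferInstance, f.gnsStarAlgHom, ξ, fun a => ?_, ?_⟩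
  · rw [hξ, UniformSpace.Completion.inner_coe, PositiveLinearMap.preGNS_inner_def]
    simp only [PositiveLinearMap.ofPreGNS_toPreGNS, star_one, one_mul]
    rfl
  · have h1 : DenseRange ((↑) : f.PreGNS → f.GNS) := UniformSpace.Completion.denseRange_coe
    simp only [hξ]
    exact h1.comp f.toPreGNS.surjective.denseRange
      (UniformSpace.Completion.continuous_coe _)

variable {H : Type u} [NormedAddCommGroup H] [InnerProductSpace ℂ H] [CompleteSpace H]
  (π : A →⋆ₐ[ℂ] (H →L[ℂ] H))

lemma inner_rep (a : A) (v w : H) : inner ℂ v (π a w) = inner ℂ (π (star a) v) w := by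
  rw [map_star, ContinuousLinearMap.star_eq_adjoint, ContinuousLinearMap.adjoint_inner_left]

lemma inner_rep_star_mul (a : A) (v : H) : inner ℂ v (π (star a * a) v) = (‖π a v‖ : ℂ) ^ 2 := by
  rw [map_mul, mul_apply_eq_comp, inner_rep, star_star]
  exact inner_self_eq_norm_sq_to_K _

/-- An invariant closed subspace `K` splits the cyclic vector `ξ` into `η + ζ`, and the vector state
of `ξ` into the functionals of `η` and `ζ`.  If that state is extreme among those with which `η` and
`ζ` compete, then `η` and `ζ` are multiples of `ξ`, so that one of them vanishes. -/
lemma isIrreducibleRep_of_extreme {ξ : H} (hξ : ‖ξ‖ = 1) (hcyc : DenseRange fun a => π a ξ)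
    {p : A} (hp : π p ξ = ξ)
    (hext : ∀ η ζ : H, η ≠ 0 → ζ ≠ 0 → π p η = η → π p ζ = ζ → ‖η‖ ^ 2 + ‖ζ‖ ^ 2 = 1 →
      (∀ a, inner ℂ ξ (π a ξ) = inner ℂ η (π a η) + inner ℂ ζ (π a ζ)) →
      ∀ a, inner ℂ η (π a η) = (‖η‖ : ℂ) ^ 2 * inner ℂ ξ (π a ξ)) :
    IsIrreducibleRep π := by
  have hξ0 : ξ ≠ 0 := norm_ne_zero_iff.1 (by rw [hξ]; exact one_ne_zero)
  refine ⟨⟨⟨ξ, 0, hξ0⟩⟩, fun K hK hinv => ?_⟩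
  have : CompleteSpace K := hK.completeSpace_coe
  have horth : ∀ a, ∀ w ∈ Kᗮ, π a w ∈ Kᗮ := fun a w hw => by
    rw [Submodule.mem_orthogonal]
    intro v hv
    rw [inner_rep]
    exact hw _ (hinv _ v hv)
  set η := K.starProjection ξ with hη
  set ζ := ξ - η with hζ
  have hηK : η ∈ K := K.starProjection_apply_mem ξ
  have hζK : ζ ∈ Kᗮ := K.sub_starProjection_mem_orthogonal ξ
  have hsum : ξ = η + ζ := by rw [hζ]; abel
  by_cases hη0 : η = 0
  · left
    rw [Submodule.eq_bot_iff]
    intro v hv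
    refine hcyc.eq_zero_of_inner_left ℂ fun a => ?_
    refine horth a ξ ?_ v hv
    rwa [hsum, hη0, zero_add]
  by_cases hζ0 : ζ = 0
  · right
    rw [eq_top_iff]
    rintro v -
    have hsub : Set.range (fun a => π a ξ) ⊆ K := by
      rintro _ ⟨a, rfl⟩
      refine hinv a ξ ?_
      rwa [hsum, hζ0, add_zero]
    exact closure_minimal hsub hK (hcyc v)
  exfalso
  have hcomm : ∀ a, π a η + π a ζ = π a ξ := fun a => by rw [← map_add, ← hsum]
  have hpη : π p η = η := by
    have h1 : K.starProjection ξ = π p η := by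
      refine Submodule.eq_starProjection_of_mem_orthogonal (hinv p η hηK) ?_
      have : ξ - π p η = π p ζ := by
        conv_lhs => rw [← hp, ← hcomm p]
        abel
      rw [this]
      exact horth p ζ hζK
    exact h1.symm
  have hpζ : π p ζ = ζ := by rw [hζ, map_sub, hp, hpη]
  have hηζ : ∀ a, inner ℂ η (π a ζ) = 0 := fun a => horth a ζ hζK η hηK
  have hζη : ∀ a, inner ℂ ζ (π a η) = 0 := fun a =>
    Submodule.inner_left_of_mem_orthogonal (hinv a η hηK) hζK
  have hsplit : ∀ a, inner ℂ ξ (π a ξ) = inner ℂ η (π a η) + inner ℂ ζ (π a ζ) := fun a => by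
    rw [← hcomm a]
    nth_rewrite 1 [hsum]
    rw [inner_add_left, inner_add_right, inner_add_right, hηζ, hζη, add_zero, zero_add]
  have hnorm : ‖η‖ ^ 2 + ‖ζ‖ ^ 2 = 1 := by
    have h1 := hsplit 1
    simp only [map_one, one_apply_eq_self, inner_self_eq_norm_sq_to_K, hξ] at h1
    have h2 : ((‖η‖ ^ 2 + ‖ζ‖ ^ 2 : ℝ) : ℂ) = ((1 : ℝ) : ℂ) := by
      push_cast; simpa using h1.symm
    exact Complex.ofReal_injective h2
  have hkey := hext η ζ hη0 hζ0 hpη hpζ hnorm hsplit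
  have hmul : η = ((‖η‖ : ℂ) ^ 2) • ξ := by
    refine hcyc.eq_of_inner_left ℂ fun a => ?_
    rw [inner_smul_left, ← hcomm a, inner_add_right, hηζ, add_zero, hcomm a, hkey a]
    simp
  have hn : (‖η‖ : ℂ) ^ 2 ≠ 0 := pow_ne_zero 2 (by simpa using hη0)
  have hξK : ξ ∈ K := by
    rw [← inv_smul_smul₀ hn ξ, ← hmul]
    exact K.smul_mem _ hηK
  exact hζ0 (sub_eq_zero.2 (K.starProjection_eq_self_iff.2 hξK).symm)

end Representations

end ModularPropinquity

/-! ### Primitive ideals above a closed ideal -/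

namespace ModularPropinquity

section StateSpace

variable {A : Type u} [CStarAlgebra A]

/-- The states that vanish on `S` and take the value `1` at `p`, in the weak-⋆ dual. -/
def statesVanishingOn (S : Set A) (p : A) : Set (WeakDual ℂ A) :=
  {f | (∀ a, 0 ≤ f (star a * a)) ∧ f 1 = 1 ∧ f p = 1 ∧ ∀ a ∈ S, f a = 0}

/-- A member of `statesVanishingOn` as a state. -/
noncomputable def stateOfMem {S : Set A} {p : A} {f : WeakDual ℂ A}
    (hf : f ∈ statesVanishingOn S p) : State A :=
  ⟨(WeakDual.toStrongDual f).toLinearMap, hf.1, hf.2.1⟩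

/-- A state as an element of the weak-⋆ dual. -/
noncomputable def State.toWeakDual [PartialOrder A] [StarOrderedRing A] (φ : State A) :
    WeakDual ℂ A :=
  StrongDual.toWeakDual (φ.1.mkContinuous 2 φ.norm_apply_le)

lemma isClosed_statesVanishingOn (S : Set A) (p : A) : IsClosed (statesVanishingOn S p) := by
  have hev : ∀ a : A, Continuous fun f : WeakDual ℂ A => f a := WeakDual.eval_continuous
  refine IsClosed.inter ?_ (IsClosed.inter ?_ (IsClosed.inter ?_ ?_))
  · have : {f : WeakDual ℂ A | ∀ a, 0 ≤ f (star a * a)} = ⋂ a, {f | 0 ≤ f (star a * a)} := by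
      ext; simp
    change IsClosed {f : WeakDual ℂ A | ∀ a, 0 ≤ f (star a * a)}
    exact this ▸ isClosed_iInter fun a => isClosed_Ici.preimage (hev (star a * a))
  · exact isClosed_eq (hev 1) continuous_const
  · exact isClosed_eq (hev p) continuous_const
  · have : {f : WeakDual ℂ A | ∀ a ∈ S, f a = 0} = ⋂ a ∈ S, {f | f a = 0} := by
      ext; simp
    change IsClosed {f : WeakDual ℂ A | ∀ a ∈ S, f a = 0}
    exact this ▸ isClosed_biInter fun a _ => isClosed_eq (hev a) continuous_const

variable [PartialOrder A] [StarOrderedRing A]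

lemma isCompact_statesVanishingOn (S : Set A) (p : A) : IsCompact (statesVanishingOn S p) := by
  refine (WeakDual.isCompact_closedBall (𝕜 := ℂ) (0 : StrongDual ℂ A) 2).of_isClosed_subset
    (isClosed_statesVanishingOn S p) fun f hf => ?_
  rw [Set.mem_preimage, mem_closedBall_zero_iff]
  exact ContinuousLinearMap.opNorm_le_bound _ two_pos.le (stateOfMem hf).norm_apply_le

/-- The GNS representation of an extreme point is irreducible, although `f` is only extreme among the
states that vanish on `I` and equal `1` at `p`: the representation `π` vanishes on `I` and `π p`
fixes the cyclic vector, so that the vector states into which an invariant subspace splits `f`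
satisfy these conditions too. -/
lemma exists_primitive_of_extreme {I : Ideal A} [I.IsTwoSided] {p : A} (hp : IsStarProjection p)
    {f : WeakDual ℂ A} (hf : f ∈ (statesVanishingOn (I : Set A) p).extremePoints ℝ) :
    ∃ P : PrimitiveSpectrum A, I ≤ P.1 ∧ p ∉ P.1 := by
  obtain ⟨hfK, hfext⟩ := mem_extremePoints.1 hf
  set φ := stateOfMem hfK
  have hφ : ∀ a, φ.1 a = f a := fun _ => rfl
  obtain ⟨H, _, _, _, π, ξ, hπ, hcyc⟩ := φ.exists_cyclic_rep
  have hnorm : ∀ a, (‖π a ξ‖ : ℂ) ^ 2 = φ.1 (star a * a) := fun a => by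
    rw [← hπ, inner_rep_star_mul]
  have hvan : ∀ a, φ.1 (star a * a) = 0 → π a ξ = 0 := fun a ha => by
    rw [← hnorm] at ha
    simpa using ha
  have hξ : ‖ξ‖ = 1 := by
    have h1 := hnorm 1
    rw [map_one, one_apply_eq_self, star_one, mul_one, φ.2.2] at h1
    have h2 : ((‖ξ‖ ^ 2 : ℝ) : ℂ) = ((1 : ℝ) : ℂ) := by push_cast; exact h1
    exact (pow_eq_one_iff_of_nonneg (norm_nonneg _) two_ne_zero).1 (Complex.ofReal_injective h2)
  have hpξ : π p ξ = ξ := by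
    have h1 : π (1 - p) ξ = 0 := by
      refine hvan _ ?_
      have e : star (1 - p) * (1 - p) = 1 - p := by
        rw [star_sub, star_one, hp.isSelfAdjoint.star_eq, sub_mul, mul_sub, mul_sub,
          hp.isIdempotentElem.eq]
        simp
      rw [e, map_sub, hφ, hφ, hfK.2.1, hfK.2.2.1, sub_self]
    rw [map_sub, map_one, sub_apply, one_apply_eq_self, sub_eq_zero] at h1
    exact h1.symm
  have hI : ∀ i ∈ I, π i = 0 := fun i hi => by
    refine ContinuousLinearMap.ext fun v => ?_
    refine congrFun (hcyc.equalizer (π i).continuous continuous_const ?_) v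
    funext a
    change π i (π a ξ) = 0
    rw [← mul_apply_eq_comp, ← map_mul]
    exact hvan _ (hfK.2.2.2 _ (I.mul_mem_left _ (I.mul_mem_right a hi)))
  -- the vector state of `η`, as a competitor of `f`
  have hvec : ∀ η : H, η ≠ 0 → π p η = η → ∃ g ∈ statesVanishingOn (I : Set A) p,
      ∀ a, inner ℂ η (π a η) = (‖η‖ : ℂ) ^ 2 * g a := fun η hη hpη => by
    have hη2 : (‖η‖ : ℂ) ^ 2 ≠ 0 := pow_ne_zero 2 (by simpa using hη)
    let ψ : A →ₗ[ℂ] ℂ :=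
      { toFun := fun a => ((‖η‖ : ℂ) ^ 2)⁻¹ * inner ℂ η (π a η)
        map_add' := fun a b => by
          rw [map_add, add_apply, inner_add_right, mul_add]
        map_smul' := fun t a => by
          rw [map_smul, smul_apply, inner_smul_right, RingHom.id_apply,
            smul_eq_mul]
          ring }
    have hψ : ∀ a, ψ a = ((‖η‖ : ℂ) ^ 2)⁻¹ * inner ℂ η (π a η) := fun _ => rfl
    have hself : inner ℂ η η = (‖η‖ : ℂ) ^ 2 := inner_self_eq_norm_sq_to_K η
    have hψ1 : ψ 1 = 1 := by
      rw [hψ, map_one, one_apply_eq_self, hself, inv_mul_cancel₀ hη2]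
    have hψpos : ∀ a, 0 ≤ ψ (star a * a) := fun a => by
      rw [hψ, inner_rep_star_mul, ← Complex.ofReal_pow, ← Complex.ofReal_pow, ← Complex.ofReal_inv,
        ← Complex.ofReal_mul, Complex.zero_le_real]
      positivity
    refine ⟨State.toWeakDual (⟨ψ, hψpos, hψ1⟩ : State A), ⟨hψpos, hψ1, ?_, fun a ha => ?_⟩,
      fun a => ?_⟩
    · change ψ p = 1
      rw [hψ, hpη, hself, inv_mul_cancel₀ hη2]
    · change ψ a = 0
      rw [hψ, hI a ha, zero_apply, inner_zero_right, mul_zero]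
    · change _ = _ * ψ a
      rw [hψ, mul_inv_cancel_left₀ hη2]
  have hirr : IsIrreducibleRep π := by
    refine isIrreducibleRep_of_extreme π hξ hcyc hpξ
      fun η ζ hη hζ hpη hpζ hsum hsplit a => ?_
    obtain ⟨g, hgK, hg⟩ := hvec η hη hpη
    obtain ⟨k, hkK, hk⟩ := hvec ζ hζ hpζ
    have hseg : f ∈ openSegment ℝ g k := by
      refine ⟨‖η‖ ^ 2, ‖ζ‖ ^ 2, by positivity, by positivity, hsum, ?_⟩
      refine DFunLike.ext _ _ fun a => ?_
      change ((‖η‖ ^ 2 : ℝ) : ℂ) * g a + ((‖ζ‖ ^ 2 : ℝ) : ℂ) * k a = f a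
      rw [← hφ, ← hπ, hsplit, hg, hk]
      push_cast
      rfl
    rw [hg, (hfext g hgK k hkK hseg).1, hπ, hφ]
  refine ⟨⟨RingHom.ker (π : A →+* (H →L[ℂ] H)), H, _, _, _, π, hirr, fun a => Iff.rfl⟩,
    fun i hi => hI i hi, fun hmem => ?_⟩
  have h0 : π p = 0 := hmem
  rw [h0, zero_apply] at hpξ
  rw [← hpξ, norm_zero] at hξ
  exact zero_ne_one hξ

end StateSpace

namespace IsTracialAF

variable {A : Type u} [CStarAlgebra A] [PartialOrder A] [StarOrderedRing A]
  {𝒜 : ℕ → StarSubalgebra ℂ A} {τ : State A} (h : IsTracialAF 𝒜 τ) (I : ClosedIdeal A)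
include h

/-- With `q = p (1 - 1_n)`, the state `a ↦ τ (q a q) / τ (q)` vanishes on `I ∩ A_n`. -/
lemma statesVanishingOn_inter_nonempty {n : ℕ} {p : A} (hpA : p ∈ 𝒜 n) (hp : IsStarProjection p)
    (hpI : p ∉ I.toIdeal) : (statesVanishingOn ((I.toIdeal : Set A) ∩ 𝒜 n) p).Nonempty := by
  set e := unitAt 𝒜 I n with he
  have hee : e * e = e := h.isIdempotentElem_unitAt I n
  have hes : star e = e := (h.isStarProjection_unitAt I n).isSelfAdjoint
  have hpp : p * p = p := hp.isIdempotentElem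
  have hps : star p = p := hp.isSelfAdjoint
  have hep : e * p = p * e := h.unitAt_comm I hpA
  set q := p * (1 - e) with hq
  have hqs : star q = q := by
    rw [hq, star_mul, star_sub, star_one, hes, hps, sub_mul, mul_sub, hep, one_mul, mul_one]
  have hpq : p * q = q := by rw [hq, ← mul_assoc, hpp]
  have hcc : (1 - e) * (1 - e) = 1 - e := by
    rw [mul_sub, mul_one, sub_mul, one_mul, hee, sub_self, sub_zero]
  have hcp : (1 - e) * p = p * (1 - e) := by rw [sub_mul, mul_sub, hep, one_mul, mul_one]
  have hqq : q * q = q := by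
    calc q * q = p * ((1 - e) * p) * (1 - e) := by rw [hq]; simp only [mul_assoc]
      _ = q := by rw [hcp, ← mul_assoc, hpp, mul_assoc, hcc]
  have hq0 : τ.1 q ≠ 0 := fun h0 => by
    have h1 : q = 0 := h.faithful q (by rw [hqs, hqq, h0])
    rw [hq, mul_sub, mul_one, sub_eq_zero] at h1
    exact hpI (h1 ▸ I.toIdeal.mul_mem_left p (h.unitAt_mem_ideal I n))
  have hqpos : 0 ≤ τ.1 q := by
    have := τ.2.1 q
    rwa [hqs, hqq] at this
  let ψ : A →ₗ[ℂ] ℂ :=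
    (τ.1 q)⁻¹ • (τ.1 ∘ₗ LinearMap.mulLeft ℂ q ∘ₗ LinearMap.mulRight ℂ q)
  have hψ : ∀ a, ψ a = (τ.1 q)⁻¹ * τ.1 (q * (a * q)) := fun _ => rfl
  have hψpos : ∀ a, 0 ≤ ψ (star a * a) := fun a => by
    rw [hψ]
    refine mul_nonneg (inv_nonneg.2 hqpos) ?_
    have := τ.2.1 (a * q)
    rwa [star_mul, hqs, mul_assoc, ← mul_assoc (star a)] at this
  have hψ1 : ψ 1 = 1 := by rw [hψ, one_mul, hqq, inv_mul_cancel₀ hq0]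
  refine ⟨State.toWeakDual (⟨ψ, hψpos, hψ1⟩ : State A), hψpos, hψ1, ?_, fun a ha => ?_⟩
  · change ψ p = 1
    rw [hψ, hpq, hqq, inv_mul_cancel₀ hq0]
  · change ψ a = 0
    have : q * a = 0 := by
      rw [hq, mul_assoc, sub_mul, one_mul, h.unitAt_mul I ha.1 ha.2, sub_self, mul_zero]
    rw [hψ, ← mul_assoc, this, zero_mul, map_zero, mul_zero]

/-- The states that vanish on `I ∩ A_n` form a decreasing sequence of compact sets; a state in all of
them vanishes on `I` by density. -/
lemma statesVanishingOn_nonempty {N : ℕ} {p : A} (hpA : p ∈ 𝒜 N) (hp : IsStarProjection p)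
    (hpI : p ∉ I.toIdeal) : (statesVanishingOn (I.toIdeal : Set A) p).Nonempty := by
  obtain ⟨f, hf⟩ := IsCompact.nonempty_iInter_of_sequence_nonempty_isCompact_isClosed
    (fun k => statesVanishingOn ((I.toIdeal : Set A) ∩ 𝒜 (N + k)) p)
    (fun k f hf => ⟨hf.1, hf.2.1, hf.2.2.1, fun a ha =>
      hf.2.2.2 a ⟨ha.1, h.mono (by omega) ha.2⟩⟩)
    (fun k => h.statesVanishingOn_inter_nonempty I (h.mono (by omega) hpA) hp hpI)
    (isCompact_statesVanishingOn _ _) (fun k => isClosed_statesVanishingOn _ _)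
  rw [Set.mem_iInter] at hf
  refine ⟨f, (hf 0).1, (hf 0).2.1, (hf 0).2.2.1, fun a ha => ?_⟩
  have hcl : IsClosed {a : A | f a = 0} :=
    isClosed_eq (WeakDual.toStrongDual f).continuous continuous_const
  refine hcl.closure_subset (Metric.mem_closure_iff.2 fun ε hε => ?_)
  obtain ⟨n, b, hb, hbI, hab⟩ := h.exists_mem_ideal_norm_sub_lt I ha hε
  exact ⟨b, (hf n).2.2.2 b ⟨hbI, h.mono (by omega) hb⟩, by rwa [dist_eq_norm]⟩

/-- A closed ideal contains each projection of `⋃ A_n` that lies in all primitive ideals above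
it. -/
lemma exists_primitive {N : ℕ} {p : A} (hpA : p ∈ 𝒜 N) (hp : IsStarProjection p)
    (hpI : p ∉ I.toIdeal) : ∃ P ∈ hull I, p ∉ P.1 := by
  have : LocallyConvexSpace ℝ (WeakDual ℂ A) := WeakBilin.locallyConvexSpace
  obtain ⟨f, hf⟩ := (isCompact_statesVanishingOn (I.toIdeal : Set A) p).extremePoints_nonempty
    (h.statesVanishingOn_nonempty I hpA hp hpI)
  exact exists_primitive_of_extreme hp hf

end IsTracialAF
end ModularPropinquity

/-! ### The Fell topology -/

namespace ModularPropinquity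

section Primitive

variable {A : Type u} [CStarAlgebra A]

lemma PrimitiveSpectrum.isTwoSided (P : PrimitiveSpectrum A) : P.1.IsTwoSided := by
  obtain ⟨H, _, _, _, π, -, hP⟩ := P.2
  exact ⟨fun b ha => (hP _).2 (by rw [map_mul, (hP _).1 ha, zero_mul])⟩

lemma PrimitiveSpectrum.isClosed (P : PrimitiveSpectrum A) : IsClosed (P.1 : Set A) := by
  obtain ⟨H, _, _, _, π, -, hP⟩ := P.2
  have : (P.1 : Set A) = {a | π a = 0} := Set.ext hP
  rw [this]
  have hπ : Continuous π :=
    AddMonoidHomClass.continuous_of_bound π 1 fun a => by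
      rw [one_mul]; exact NonUnitalStarAlgHom.norm_apply_le π a
  exact isClosed_eq hπ continuous_const

/-- A primitive ideal as a closed ideal. -/
def PrimitiveSpectrum.toClosedIdeal (P : PrimitiveSpectrum A) : ClosedIdeal A :=
  ⟨P.1, P.isTwoSided, P.isClosed⟩

/-- The complement is the hull of the intersection of the primitive ideals that contain `p`. -/
lemma isOpen_setOf_notMem (p : A) : IsOpen {P : PrimitiveSpectrum A | p ∉ P.1} := by
  let J : Ideal A := ⨅ P : {P : PrimitiveSpectrum A // p ∈ P.1}, P.1.1
  have hJ : ∀ a, a ∈ J ↔ ∀ P : {P : PrimitiveSpectrum A // p ∈ P.1}, a ∈ P.1.1 :=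
    fun a => Submodule.mem_iInf _
  have hts : J.IsTwoSided := ⟨fun b ha => (hJ _).2 fun P =>
    have := P.1.isTwoSided
    P.1.1.mul_mem_right b ((hJ _).1 ha P)⟩
  have hcl : IsClosed (J : Set A) := by
    have : (J : Set A) = ⋂ P : {P : PrimitiveSpectrum A // p ∈ P.1}, (P.1.1 : Set A) := by
      ext a
      simpa using hJ a
    rw [this]
    exact isClosed_iInter fun P => P.1.isClosed
  refine TopologicalSpace.isOpen_generateFrom_of_mem ⟨⟨J, hts, hcl⟩, ?_⟩
  ext P
  refine not_congr ⟨fun hp a ha => (hJ a).1 ha ⟨P, hp⟩, fun hP => hP ((hJ p).2 fun Q => Q.2)⟩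

/-- The closed ideal generated by a set of closed ideals. -/
noncomputable def closedSup (T : Set (ClosedIdeal A)) : ClosedIdeal A where
  toIdeal := (⨆ I : T, I.1.toIdeal).closure
  isTwoSided := by
    have hsup : ∀ a b : A, a ∈ ⨆ I : T, I.1.toIdeal → a * b ∈ ⨆ I : T, I.1.toIdeal := by
      intro a b ha
      induction ha using Submodule.iSup_induction' with
      | mem I x hx => exact Submodule.mem_iSup_of_mem I (I.1.toIdeal.mul_mem_right b hx)
      | zero => rw [zero_mul]; exact zero_mem _
      | add x y _ _ hx hy => rw [add_mul]; exact add_mem hx hy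
    refine ⟨fun {a} b ha => ?_⟩
    exact map_mem_closure (f := fun x => x * b) (continuous_mul_const b) ha fun x hx => hsup x b hx
  isClosed := isClosed_closure

end Primitive

namespace IsTracialAF

variable {A : Type u} [CStarAlgebra A] [PartialOrder A] [StarOrderedRing A]
  {𝒜 : ℕ → StarSubalgebra ℂ A} {τ : State A} (h : IsTracialAF 𝒜 τ)
include h

/-- If `p` lies in the closed ideal generated by a family of ideals, then it is at distance less
than `1` from a finite sum of elements of these ideals, which suffices to put it into any closed
ideal that contains the finitely many ideals involved. -/
lemma isCompact_setOf_notMem {N : ℕ} {p : A} (hpA : p ∈ 𝒜 N) (hp : IsStarProjection p) :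
    IsCompact {P : PrimitiveSpectrum A | p ∉ P.1} := by
  refine isCompact_generateFrom rfl fun 𝒰 h𝒰 hcov => ?_
  let T : Set (ClosedIdeal A) := {I | (hull I)ᶜ ∈ 𝒰}
  have hpJ : p ∈ (closedSup T).toIdeal := by
    by_contra hpJ
    obtain ⟨P, hP, hpP⟩ := h.exists_primitive (closedSup T) hpA hp hpJ
    obtain ⟨U, hU, hPU⟩ := hcov hpP
    obtain ⟨I, rfl⟩ := h𝒰 hU
    refine hPU fun a ha => hP (subset_closure ?_)
    exact Submodule.mem_iSup_of_mem (⟨I, hU⟩ : T) ha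
  obtain ⟨i, hi, hpi⟩ := Metric.mem_closure_iff.1 hpJ 1 one_pos
  obtain ⟨F, hF⟩ := (Submodule.mem_iSup_iff_exists_finset).1 hi
  refine ⟨(fun I : T => (hull I.1)ᶜ) '' F, ?_, F.finite_toSet.image _, fun P hP => ?_⟩
  · rintro _ ⟨I, -, rfl⟩
    exact I.2
  · by_contra hcon
    have hle : ⨆ I ∈ F, I.1.toIdeal ≤ P.1 := iSup₂_le fun I hI => by
      by_contra hIP
      exact hcon ⟨_, ⟨I, hI, rfl⟩, hIP⟩
    rw [dist_eq_norm] at hpi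
    exact hP (P.toClosedIdeal.mem_of_norm_sub_lt_one hp.isIdempotentElem (hle hF) hpi)

lemma isOpen_setOf_mem {N : ℕ} {p : A} (hpA : p ∈ 𝒜 N) (hp : IsStarProjection p) :
    IsOpen {I : ClosedIdeal A | p ∈ I.toIdeal} := by
  have hopen : IsOpen[fellTopology (PrimitiveSpectrum A)]
      {Y : TopologicalSpace.Closeds (PrimitiveSpectrum A) |
        Disjoint (Y : Set (PrimitiveSpectrum A)) {P | p ∉ P.1}} :=
    TopologicalSpace.isOpen_generateFrom_of_mem
      (Or.inl ⟨_, h.isCompact_setOf_notMem hpA hp, rfl⟩)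
  refine ⟨_, hopen, ?_⟩
  ext I
  refine ⟨fun hI => ?_, fun hI => Set.disjoint_left.2 fun P hP hpP => hpP (hP hI)⟩
  by_contra hpI
  obtain ⟨P, hP, hpP⟩ := h.exists_primitive I hpA hp hpI
  exact Set.disjoint_left.1 hI hP hpP

lemma isOpen_setOf_notMem_ideal {N : ℕ} {p : A} (hpA : p ∈ 𝒜 N) (hp : IsStarProjection p) :
    IsOpen {I : ClosedIdeal A | p ∉ I.toIdeal} := by
  have hopen : IsOpen[fellTopology (PrimitiveSpectrum A)]
      {Y : TopologicalSpace.Closeds (PrimitiveSpectrum A) |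
        ((Y : Set (PrimitiveSpectrum A)) ∩ {P | p ∉ P.1}).Nonempty} :=
    TopologicalSpace.isOpen_generateFrom_of_mem (Or.inr ⟨_, isOpen_setOf_notMem p, rfl⟩)
  refine ⟨_, hopen, ?_⟩
  ext I
  exact ⟨fun ⟨P, hP, hpP⟩ hI => hpP (hP hI), fun hI => h.exists_primitive I hpA hp hI⟩

omit h in
omit [PartialOrder A] [StarOrderedRing A] in
/-- For commuting projections, `p - p q = p (p - q)` is an idempotent of norm less than `1`, hence
zero, and likewise with `p` and `q` exchanged. -/
lemma eq_of_commute_of_norm_sub_lt_one {p q : A} (hp : IsStarProjection p)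
    (hq : IsStarProjection q) (hpq : p * q = q * p) (hlt : ‖p - q‖ < 1) : p = q := by
  have key : ∀ {p q : A}, IsStarProjection p → IsStarProjection q → p * q = q * p →
      ‖p - q‖ < 1 → p = p * q := fun {p q} hp hq hpq hlt => by
    have hr : IsIdempotentElem (p - p * q) := by
      have h1 : p * p = p := hp.isIdempotentElem
      have h2 : q * q = q := hq.isIdempotentElem
      have h3 : p * (p * q) = p * q := by rw [← mul_assoc, h1]
      have h4 : p * q * p = p * q := by rw [mul_assoc, ← hpq, h3]
      have h5 : p * q * (p * q) = p * q := by rw [← mul_assoc, h4, mul_assoc, h2]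
      rw [IsIdempotentElem, mul_sub, sub_mul, sub_mul, h1, h3, h4, h5]
      abel
    have hn : ‖p - p * q‖ < 1 := by
      have e : p - p * q = p * (p - q) := by rw [mul_sub, hp.isIdempotentElem.eq]
      rw [e]
      refine (norm_mul_le _ _).trans_lt ?_
      exact (mul_le_of_le_one_left (norm_nonneg _) hp.norm_le).trans_lt hlt
    have h0 := tendsto_pow_atTop_nhds_zero_of_norm_lt_one hn
    have h1 : Filter.Tendsto (fun m : ℕ => (p - p * q) ^ (m + 1)) Filter.atTop (𝓝 0) :=
      h0.comp (Filter.tendsto_add_atTop_nat 1)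
    simp only [hr.pow_succ_eq] at h1
    exact sub_eq_zero.1 (tendsto_nhds_unique tendsto_const_nhds h1)
  rw [key hp hq hpq hlt, hpq]
  exact (key hq hp hpq.symm (by rwa [norm_sub_rev])).symm

omit [PartialOrder A] [StarOrderedRing A] in
/-- Distinct commuting projections are at distance at least `1`, and the unit ball of `A_n` is totally
bounded. -/
lemma finite_central_projections (n : ℕ) :
    {p : A | p ∈ 𝒜 n ∧ IsStarProjection p ∧ ∀ b ∈ 𝒜 n, p * b = b * p}.Finite := by
  obtain ⟨t, htfin, ht⟩ := Metric.totallyBounded_iff.1 (h.isCompact_ball n 1).totallyBounded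
    (1 / 2) (by norm_num)
  have hex : ∀ p : A, ∃ y, p ∈ 𝒜 n ∧ ‖p‖ ≤ 1 → y ∈ t ∧ dist p y < 1 / 2 := fun p => by
    by_cases hp : p ∈ 𝒜 n ∧ ‖p‖ ≤ 1
    · obtain ⟨y, hy, hpy⟩ := Set.mem_iUnion₂.1 (ht hp)
      exact ⟨y, fun _ => ⟨hy, hpy⟩⟩
    · exact ⟨0, fun h => absurd h hp⟩
  choose f hf using hex
  refine Set.Finite.of_injOn (f := f) (fun p hp => (hf p ⟨hp.1, hp.2.1.norm_le⟩).1)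
    (fun p hp q hq hpq => ?_) htfin
  refine eq_of_commute_of_norm_sub_lt_one hp.2.1 hq.2.1 (hp.2.2 q hq.1) ?_
  have h1 := (hf p ⟨hp.1, hp.2.1.norm_le⟩).2
  have h2 := (hf q ⟨hq.1, hq.2.1.norm_le⟩).2
  rw [← dist_eq_norm]
  rw [← hpq, dist_comm] at h2
  linarith [dist_triangle p (f p) q]

/-- The Fell topology makes `I ↦ I ∩ A_n` locally constant: this ideal of `A_n` is determined by the
finitely many central projections of `A_n` that it contains. -/
lemma eventually_inter_eq (I : ClosedIdeal A) (n : ℕ) :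
    ∀ᶠ I' in 𝓝 I, ∀ x ∈ 𝒜 n, x ∈ I'.toIdeal ↔ x ∈ I.toIdeal := by
  have hev : ∀ᶠ I' in 𝓝 I,
      ∀ p ∈ {p : A | p ∈ 𝒜 n ∧ IsStarProjection p ∧ ∀ b ∈ 𝒜 n, p * b = b * p},
        p ∈ I'.toIdeal ↔ p ∈ I.toIdeal := by
    rw [Filter.eventually_all_finite (h.finite_central_projections n)]
    intro p hp
    by_cases hpI : p ∈ I.toIdeal
    · filter_upwards [(h.isOpen_setOf_mem hp.1 hp.2.1).mem_nhds hpI] with I' hI'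
      exact iff_of_true hI' hpI
    · filter_upwards [(h.isOpen_setOf_notMem_ideal hp.1 hp.2.1).mem_nhds hpI] with I' hI'
      exact iff_of_false hI' hpI
  filter_upwards [hev] with I' hI' x hx
  have hunit : ∀ J : ClosedIdeal A, unitAt 𝒜 J n ∈
      {p : A | p ∈ 𝒜 n ∧ IsStarProjection p ∧ ∀ b ∈ 𝒜 n, p * b = b * p} := fun J =>
    ⟨h.unitAt_mem J n, h.isStarProjection_unitAt J n, fun b hb => h.unitAt_comm J hb⟩
  constructor
  · intro hxI
    rw [← h.mul_unitAt I' hxI hx]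
    exact I.toIdeal.mul_mem_left x ((hI' _ (hunit I')).1 (h.unitAt_mem_ideal I' n))
  · intro hxI
    rw [← h.mul_unitAt I hxI hx]
    exact I'.toIdeal.mul_mem_left x ((hI' _ (hunit I)).2 (h.unitAt_mem_ideal I n))

end IsTracialAF
end ModularPropinquity

theorem mainTheorem1 {A : Type u} [CStarAlgebra A] [PartialOrder A] [StarOrderedRing A]
    (𝒜 : ℕ → StarSubalgebra ℂ A) (h_mono : Monotone 𝒜) (h_zero : 𝒜 0 = ⊥)
    (h_fin : ∀ n, FiniteDimensional ℂ (𝒜 n)) (h_dense : Dense (⋃ n, (𝒜 n : Set A)))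
    (τ : State A) (h_tracial : ∀ a b : A, τ.1 (a * b) = τ.1 (b * a))
    (h_faithful : ∀ a : A, τ.1 (star a * a) = 0 → a = 0)
    (β : ℕ → ℝ) (hβ_pos : ∀ n, 0 < β n)
    (hβ : Filter.Tendsto β Filter.atTop (𝓝 0))
    (hβ_ratio : Filter.Tendsto (fun n => β (n + 1) / β n) Filter.atTop (𝓝 0)) :
    ∃ h : ∀ I : ClosedIdeal A,
      IsMetrizedBundle afF afG
        afH (afBundle 𝒜 τ β I),
      Continuous fun I : ClosedIdeal A =>
        (⟨afBundle 𝒜 τ β I, h I⟩ :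
          MetrizedBundle afF afG
            afH) := by
  have h : IsTracialAF 𝒜 τ := ⟨h_mono, h_zero, h_fin, h_dense, h_tracial, h_faithful⟩
  refine ⟨fun I => h.isMetrizedBundle I hβ_pos hβ, continuous_iff_continuousAt.2 fun I => ?_⟩
  refine EMetric.tendsto_nhds.2 fun ε hε => ?_
  obtain ⟨δ, hδ0, hδ⟩ := ENNReal.lt_iff_exists_nnreal_btwn.1 hε
  have hδ0' : (0 : ℝ) < δ / 4 := by
    have : (0 : ℝ) < δ := by exact_mod_cast hδ0
    positivity
  obtain ⟨N, hN, hN'⟩ := IsTracialAF.exists_le_mul_of_ratio hβ_pos hβ hβ_ratio hδ0'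
  filter_upwards [h.eventually_inter_eq I N] with I' hI'
  refine lt_of_le_of_lt ?_ hδ
  refine (iInf_le _ (Trek.single (h.idealBridge (β := β) hI'))).trans ?_
  refine (h.length_idealBridge_le hβ_pos hI' hδ0' hN hN').trans_eq ?_
  rw [mul_div_cancel₀ _ four_ne_zero, ENNReal.ofReal_coe_nnreal]
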